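/- Let $M$ be a compact smooth manifold (Hausdorff, finite-dimensional, without boundary), let $\pi : T^*M \to M$ be its cotangent bundle, and let $\nabla$ be a smooth connection on $T^*M$. Equip $TM$ with the dual connection, given by $\theta(\nabla_X Y) = X(\theta(Y)) - (\nabla_X\theta)(Y)$ for all $1$-forms $\theta$. For $f \in C^\infty(M)$ let $\nabla^k f$ be its $k$-th covariant derivative, i.e. the covariant $k$-tensor field with $\nabla^0 f = f$ and $$(\nabla^{k+1} f)(X_1,\dots,X_{k+1}) = X_{k+1}\big((\nabla^k f)(X_1,\dots,X_k)\big) - \sum_{i=1}^k (\nabla^k f)(X_1,\dots,\nabla_{X_{k+1}}X_i,\dots,X_k)$$ for smooth vector fields $X_1,\dots,X_{k+1}$, and let $$(\partial^k f)(X_1,\dots,X_k) = \frac{1}{k!}\sum_{\sigma \in S_k} (\nabla^k f)(X_{\sigma(1)},\dots,X_{\sigma(k)})$$ be its symmetrization. Then there exists a function $l \in C^\infty(T^*M \times M)$, real-valued, such that 1. for every $x \in M$, the function $l(\cdot,x)$ is linear on each fibre $T^*_yM$, $y \in M$; 2. for every $v \in T^*M$ and every integer $k \ge 0$, with $\partial^k$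 acting on the function $x \mapsto l(v,x)$, $$\partial^k l(v,x)\big|_{x=\pi(v)} = \begin{cases} v & \text{if } k = 1,\\ 0 & \text{otherwise.}\end{cases}$$ In particular (the case $k=0$) $l(v,\pi(v)) = 0$. -/

import Mathlib

open Bundle FiberBundle
open scoped Manifold ContDiff

namespace LinearPhase

variable {E : Type*} [NormedAddCommGroup E] [NormedSpace ℝ E]
  {H : Type*} [TopologicalSpace H] (I : ModelWithCorners ℝ E H)
  {M : Type*} [TopologicalSpace M] [ChartedSpace H M]

/-- The cotangent space `T*_x M`. -/
abbrev CotangentSpace (x : M) : Type _ := TangentSpace I x →L[ℝ] ℝ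

variable (M) in
/-- The cotangent bundle `T*M`, as the bundle `Hom(TM, ℝ)`; its points are pairs `v = ⟨π v, v.2⟩`
and its projection is `π v = v.proj`. -/
abbrev CotangentBundle : Type _ :=
  TotalSpace (E →L[ℝ] ℝ) (fun x : M ↦ CotangentSpace I x)

variable {I} [FiniteDimensional ℝ E] [IsManifold I ∞ M]

/-- The chosen basis of `T_x M`, which is the model space `E` by definition. -/
noncomputable def tangentBasis (x : M) :
    Module.Basis (Fin (Module.finrank ℝ E)) ℝ (TangentSpace I x) :=
  Module.finBasis ℝ E

/-- The covectors of the dual basis of `T*_x M`. -/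
noncomputable def cotangentBasis (x : M) (j : Fin (Module.finrank ℝ E)) : CotangentSpace I x :=
  (LinearMap.toContinuousLinearMap ((Module.finBasis ℝ E).coord j) : E →L[ℝ] ℝ)

/-- The connection on `TM` dual to a connection `cov` on `T*M`. It is characterised by
`θ (∇_w Y) = w (θ Y) - (∇_w θ) (Y)` for all 1-forms `θ` (see `cotangent_dualConnection_apply`); here
this identity is read off on differentiable 1-forms extending a basis of `T*_x M`.
As in Mathlib's `CovariantDerivative`, `dualConnection cov Y x w` is `∇_w Y` at `x`. -/
noncomputable def dualConnection
    (cov : CovariantDerivative I (E →L[ℝ] ℝ) (fun x : M ↦ CotangentSpace I x))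
    (Y : Π x : M, TangentSpace I x) (x : M) (w : TangentSpace I x) : TangentSpace I x :=
  let θ (j : Fin (Module.finrank ℝ E)) : Π y : M, CotangentSpace I y :=
    extend (E →L[ℝ] ℝ) (cotangentBasis x j)
  ∑ j, (mvfderiv I (fun y : M ↦ θ j y (Y y)) x w - cov (θ j) x w (Y x)) • tangentBasis x j

/-- The defining property of the dual connection. -/
theorem cotangent_dualConnection_apply
    (cov : CovariantDerivative I (E →L[ℝ] ℝ) (fun x : M ↦ CotangentSpace I x))
    {Y : Π x : M, TangentSpace I x} {θ : Π x : M, CotangentSpace I x} {x : M}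
    (hY : MDiffAt (T% Y) x)
    (hθ : MDifferentiableAt I (I.prod 𝓘(ℝ, E →L[ℝ] ℝ))
      (fun y ↦ TotalSpace.mk' (E →L[ℝ] ℝ) y (θ y)) x)
    (w : TangentSpace I x) :
    θ x (dualConnection cov Y x w) =
      mvfderiv I (fun y : M ↦ θ y (Y y)) x w - cov θ x w (Y x) := by
  have happ : ∀ {η : Π x : M, CotangentSpace I x}, MDifferentiableAt I (I.prod 𝓘(ℝ, E →L[ℝ] ℝ))
      (fun y ↦ TotalSpace.mk' (E →L[ℝ] ℝ) y (η y)) x → MDiffAt (fun y : M ↦ η y (Y y)) x := by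
    intro η hη
    have h := MDifferentiableAt.clm_bundle_apply (F₁ := E) (F₂ := ℝ)
      (E₁ := fun y : M ↦ TangentSpace I y) (E₂ := Bundle.Trivial M ℝ) (b := fun y ↦ y) hη hY
    simp only [mdifferentiableAt_totalSpace] at h
    exact h.2
  have hΦ : TensorialAt I (E →L[ℝ] ℝ) (fun η : Π x : M, CotangentSpace I x ↦
      mvfderiv I (fun y : M ↦ η y (Y y)) x w - cov η x w (Y x)) x := by
    constructor
    · intro f η hf hη
      have h1 := mvfderiv_fun_mul hf (happ hη)
      have h2 := cov.isCovariantDerivativeOn.leibniz hη hf (Set.mem_univ x)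
      simp [h1, h2]
      ring
    · intro η η' hη hη'
      have h1 := mvfderiv_fun_add (happ hη) (happ hη')
      have h2 := cov.isCovariantDerivativeOn.add hη hη' (Set.mem_univ x)
      simp [h1, h2]
      ring
  have hcoord (j) (u : TangentSpace I x) : cotangentBasis x j u = (tangentBasis x).repr u j := rfl
  have hθx : θ x = ∑ j, θ x (tangentBasis x j) • cotangentBasis x j := by
    ext u
    conv_lhs => rw [← (tangentBasis x).sum_repr u, map_sum]
    simp only [map_smul, _root_.sum_apply, _root_.smul_apply, hcoord, smul_eq_mul, mul_comm]
  have key : TensorialAt.mkHom _ x hΦ (θ x) =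
      ∑ j, θ x (tangentBasis x j) • TensorialAt.mkHom _ x hΦ (cotangentBasis x j) := by
    conv_lhs => rw [hθx]
    simp only [map_sum, map_smul]
  rw [TensorialAt.mkHom_apply hΦ hθ] at key
  rw [key]
  simp only [TensorialAt.mkHom_apply_eq_extend]
  simp [dualConnection, mul_comm]

/-- The `k`-th covariant derivative `∇ᵏ f` of a function, as a covariant `k`-tensor field evaluated
on vector fields `X 0, …, X (k - 1)`: `∇⁰ f = f`, and `∇ᵏ⁺¹ f` is the covariant derivative of the
tensor field `∇ᵏ f`, i.e. `(∇ᵏ⁺¹ f) (X 0, …, X k) = X k ((∇ᵏ f) (X 0, …, X (k - 1)))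
  - ∑ i < k, (∇ᵏ f) (X 0, …, ∇_{X k} (X i), …, X (k - 1))`. -/
noncomputable def iteratedCovDeriv
    (cov : CovariantDerivative I (E →L[ℝ] ℝ) (fun x : M ↦ CotangentSpace I x)) (f : M → ℝ) :
    (k : ℕ) → (Fin k → Π x : M, TangentSpace I x) → M → ℝ
  | 0, _ => f
  | k + 1, X => fun x ↦
      mvfderiv I (iteratedCovDeriv cov f k (Fin.init X)) x (X (Fin.last k) x)
        - ∑ i : Fin k, iteratedCovDeriv cov f k (Function.update (Fin.init X) i
            (fun y ↦ dualConnection cov (Fin.init X i) y (X (Fin.last k) y))) x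

/-- The symmetrized `k`-th covariant derivative `∂ᵏ f`. -/
noncomputable def symCovDeriv
    (cov : CovariantDerivative I (E →L[ℝ] ℝ) (fun x : M ↦ CotangentSpace I x)) (f : M → ℝ)
    (k : ℕ) (X : Fin k → Π x : M, TangentSpace I x) (x : M) : ℝ :=
  (k.factorial : ℝ)⁻¹ * ∑ s : Equiv.Perm (Fin k), iteratedCovDeriv cov f k (fun i ↦ X (s i)) x

end LinearPhase

/-! Choose smooth functions `h a` and vector fields `Z a`, finitely many, with `w = ∑ a, dh_a(w)
Z_a` for every tangent vector `w` (`exists_isDualFrame`). Suppose each `g = h a` has a smooth `F a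
(y, x)` whose symmetrized derivatives in `x` at `x = y` are `dg` in order 1 and zero in every other
order. Then `l (v, x) = ∑ a, v(Z_a) F a (π v, x)` solves the problem, since `∑ a, v(Z_a) dh_a = v`.

To build `F` from `g`, start with `g x - g y` and remove the orders `n ≥ 2` one after the other,
subtracting a homogeneous polynomial of degree `n` in `h x - h y` with coefficients `(n!)⁻¹ ∇ⁿ(Z_{a
1}, …, Z_{a n})` taken at `y`. It vanishes to order `n` at `y`, so lower orders are untouched. Its
`∇ⁿ` at `y` is its iterated Lie derivative, because the connection terms are of lower order
(`vanishesTo_iteratedCovDeriv`); by tensoriality (`exists_multilinearMap`) this is exactly the `∂ⁿ`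
to be removed (`symCovDeriv_polynomial`).

The infinitely many corrections are summed by Borel's lemma with parameters
(`exists_contDiff_forall_flatAt`) on `ℝᴺ × ℝᴺ`, evaluated at `(h y, h x - h y)`. For this the
coefficients, which are functions on `M`, are extended to compactly supported functions on `ℝᴺ`. -/

namespace LinearPhase

/-! ### Flat functions and Borel's lemma with parameters. -/

section Borel

variable {V : Type*} [NormedAddCommGroup V] [NormedSpace ℝ V]

/-- All derivatives of `f` of order less than `k` vanish at `p`. -/
def FlatAt (k : ℕ) (f : V → ℝ) (p : V) : Prop :=
  ∀ j < k, iteratedFDeriv ℝ j f p = 0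

/-- In the Leibniz formula for a derivative of order `j < k + m`, each term has fewer than `k`
derivatives on `f` or fewer than `m` on `g`. -/
theorem FlatAt.mul {k m : ℕ} {f g : V → ℝ} {p : V} (hf : ContDiff ℝ ∞ f) (hg : ContDiff ℝ ∞ g)
    (hfk : FlatAt k f p) (hgm : FlatAt m g p) : FlatAt (k + m) (fun x ↦ f x * g x) p := by
  intro j hj
  have h := norm_iteratedFDeriv_mul_le hf hg p (n := j) (by exact_mod_cast le_top)
  rw [← norm_le_zero_iff]
  refine h.trans (Finset.sum_nonpos fun i hij ↦ ?_)
  have hij := Finset.mem_range.1 hij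
  rcases lt_or_ge i k with hi | hi
  · simp [hfk i hi]
  · simp [hgm (j - i) (by omega)]

theorem FlatAt.mul_left {m : ℕ} {f g : V → ℝ} {p : V} (hf : ContDiff ℝ ∞ f) (hg : ContDiff ℝ ∞ g)
    (hgm : FlatAt m g p) : FlatAt m (fun x ↦ f x * g x) p := by
  simpa using FlatAt.mul (k := 0) hf hg (fun j hj ↦ by omega) hgm

theorem FlatAt.prod {ι : Type*} (s : Finset ι) {f : ι → V → ℝ} {p : V}
    (hf : ∀ i, ContDiff ℝ ∞ (f i)) (h0 : ∀ i, f i p = 0) :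
    FlatAt s.card (fun x ↦ ∏ i ∈ s, f i x) p := by
  classical
  induction s using Finset.induction_on with
  | empty => intro j hj; simp at hj
  | insert a s ha ih =>
    rw [Finset.card_insert_of_notMem ha, add_comm]
    simp only [Finset.prod_insert ha]
    refine FlatAt.mul (hf a) (contDiff_prod fun i _ ↦ hf i) ?_ ih
    intro j hj
    obtain rfl : j = 0 := by omega
    ext
    simp [h0]

theorem FlatAt.sum {ι : Type*} (s : Finset ι) {k : ℕ} {f : ι → V → ℝ} {p : V}
    (hf : ∀ i, ContDiff ℝ ∞ (f i)) (h : ∀ i, FlatAt k (f i) p) :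
    FlatAt k (fun x ↦ ∑ i ∈ s, f i x) p := by
  intro j hj
  rw [iteratedFDeriv_fun_sum_apply fun i _ ↦ (hf i).contDiffAt.of_le (by exact_mod_cast le_top)]
  exact Finset.sum_eq_zero fun i _ ↦ h i j hj

theorem FlatAt.congr {k : ℕ} {f g : V → ℝ} {p : V} (hf : FlatAt k f p)
    (h : f =ᶠ[nhds p] g) : FlatAt k g p :=
  fun j hj ↦ by rw [← (h.iteratedFDeriv ℝ j).eq_of_nhds, hf j hj]

section Series

variable {f : ℕ → V → ℝ} (hf : ∀ n, ContDiff ℝ ∞ (f n))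
  (hb : ∀ n, ∀ j < n, ∀ x, ‖iteratedFDeriv ℝ j (f n) x‖ ≤ (1 / 2 : ℝ) ^ n)

include hf hb in
-- The bound on order `j` fails to cover only the finitely many `n ≤ j`, which do not affect
-- smoothness of the sum.
theorem contDiff_tsum_of_geometric : ContDiff ℝ ∞ (fun x ↦ ∑' n, f n x) := by
  refine contDiff_tsum_of_eventually (N := ⊤) (v := fun _ n ↦ (1 / 2 : ℝ) ^ n) hf
    (fun _ _ ↦ summable_geometric_two) fun k _ ↦ ?_
  rw [Nat.cofinite_eq_atTop]
  filter_upwards [Filter.eventually_gt_atTop k] with n hn x using hb n k hn x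

include hb in
theorem summable_of_geometric (x : V) : Summable (fun n ↦ f n x) := by
  refine Summable.of_norm_bounded_eventually (g := fun n ↦ (1 / 2 : ℝ) ^ n)
    summable_geometric_two ?_
  rw [Nat.cofinite_eq_atTop]
  filter_upwards [Filter.eventually_gt_atTop 0] with n hn
  simpa using hb n 0 hn x

include hf hb in
-- With the first `K` terms dropped, `hb` covers every order below `K` for all remaining terms, so
-- the series can be differentiated term by term.
theorem flatAt_tsum_of_geometric {p : V} {K : ℕ} (hflat : ∀ n, FlatAt n (f n) p) :
    FlatAt K (fun x ↦ ∑' n, f (n + K) x) p := by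
  intro j hj
  rw [iteratedFDeriv_tsum (N := j) (v := fun _ n ↦ (1 / 2 : ℝ) ^ (n + K))
    (fun n ↦ (hf _).of_le (by exact_mod_cast le_top))
    (fun _ _ ↦ (summable_nat_add_iff K).2 summable_geometric_two)
    (fun k n x hk ↦ hb _ k (by have : k ≤ j := (by exact_mod_cast hk); omega) x) le_rfl]
  have h0 (n : ℕ) : iteratedFDeriv ℝ j (f (n + K)) p = 0 := hflat _ j (by omega)
  simp [h0]

end Series

theorem exists_forall_norm_iteratedFDeriv_le {R : V → ℝ} (hR : ContDiff ℝ ∞ R)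
    (hc : HasCompactSupport R) (n : ℕ) :
    ∃ B, 0 ≤ B ∧ ∀ j < n, ∀ x, ‖iteratedFDeriv ℝ j R x‖ ≤ B := by
  have h (j : ℕ) : ∃ C, ∀ x, ‖iteratedFDeriv ℝ j R x‖ ≤ C :=
    (hR.continuous_iteratedFDeriv (m := j) (by exact_mod_cast le_top)).bounded_above_of_compact_support
      (hc.iteratedFDeriv j)
  choose C hC using h
  have hC0 (j) : 0 ≤ C j := (norm_nonneg _).trans (hC j 0)
  refine ⟨∑ j ∈ Finset.range n, C j, Finset.sum_nonneg fun j _ ↦ hC0 j, fun j hj x ↦ ?_⟩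
  exact (hC j x).trans (Finset.single_le_sum (fun i _ ↦ hC0 i) (Finset.mem_range.2 hj))

/-- Composing with `L t` costs at most `t ^ j` in order `j`. As `j < n`, the prefactor `t⁻¹ ^ n`
leaves at least one factor `t⁻¹`, which beats any fixed bound on the derivatives of `R`. -/
theorem exists_rescaling {R : V → ℝ} (hR : ContDiff ℝ ∞ R) (hc : HasCompactSupport R)
    {L : ℝ → V →L[ℝ] V} (hL : ∀ t, 1 ≤ t → ‖L t‖ ≤ t) (n : ℕ) :
    ∃ t : ℝ, 1 ≤ t ∧ ∀ j < n, ∀ x,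
      ‖iteratedFDeriv ℝ j (fun x ↦ t⁻¹ ^ n * R (L t x)) x‖ ≤ (1 / 2 : ℝ) ^ n := by
  obtain ⟨B, hB0, hB⟩ := exists_forall_norm_iteratedFDeriv_le hR hc n
  set t := max 1 (2 ^ n * B) with ht
  -- The choice of `t` gives `B / t ≤ 2⁻ⁿ`.
  have ht1 : 1 ≤ t := le_max_left _ _
  have ht0 : 0 < t := by positivity
  refine ⟨t, ht1, fun j hj x ↦ ?_⟩
  have h1 : (fun x ↦ t⁻¹ ^ n * R (L t x)) = fun x ↦ t⁻¹ ^ n • (R ∘ L t) x := rfl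
  have hcomp : ContDiff ℝ ∞ (R ∘ L t) := hR.comp (L t).contDiff
  rw [h1, iteratedFDeriv_const_smul_apply' (hcomp.contDiffAt.of_le (by exact_mod_cast le_top)),
    (L t).iteratedFDeriv_comp_right hR x (by exact_mod_cast le_top), norm_smul]
  have h2 : ‖(iteratedFDeriv ℝ j R (L t x)).compContinuousLinearMap fun _ ↦ L t‖ ≤ B * t ^ j := by
    refine (ContinuousMultilinearMap.norm_compContinuousLinearMap_le _ _).trans ?_
    rw [Finset.prod_const, Finset.card_univ, Fintype.card_fin]
    exact mul_le_mul (hB j hj _) (pow_le_pow_left₀ (norm_nonneg _) (hL t ht1) j) (by positivity) hB0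
  have h3 : t⁻¹ ^ n * t ^ j ≤ t⁻¹ := by
    obtain ⟨m, rfl⟩ : ∃ m, n = j + 1 + m := ⟨n - (j + 1), by omega⟩
    have : t⁻¹ ^ (j + 1 + m) * t ^ j = t⁻¹ * t⁻¹ ^ m := by
      have h : t⁻¹ ^ j * t ^ j = 1 := by rw [← mul_pow, inv_mul_cancel₀ ht0.ne', one_pow]
      calc t⁻¹ ^ (j + 1 + m) * t ^ j = t⁻¹ * t⁻¹ ^ m * (t⁻¹ ^ j * t ^ j) := by ring
        _ = _ := by rw [h, mul_one]
    rw [this]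
    exact mul_le_of_le_one_right (by positivity) (pow_le_one₀ (by positivity) (inv_le_one_of_one_le₀ ht1))
  have h4 : B * t⁻¹ ≤ (1 / 2) ^ n := by
    rw [← div_eq_mul_inv, div_le_iff₀ ht0, one_div, inv_pow, ← div_eq_inv_mul, le_div_iff₀ (by positivity),
      mul_comm]
    exact le_max_right _ _
  calc ‖t⁻¹ ^ n‖ * _ ≤ t⁻¹ ^ n * (B * t ^ j) := by
        rw [Real.norm_of_nonneg (by positivity)]
        gcongr
    _ = B * (t⁻¹ ^ n * t ^ j) := by ring
    _ ≤ B * t⁻¹ := by gcongr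
    _ ≤ _ := h4

variable {N : ℕ}

/-- The dilation of the second factor. -/
noncomputable def dilateSnd (W : Type*) [NormedAddCommGroup W] [NormedSpace ℝ W] (t : ℝ) :
    W × W →L[ℝ] W × W :=
  (ContinuousLinearMap.fst ℝ W W).prod (t • ContinuousLinearMap.snd ℝ W W)

theorem norm_dilateSnd_le {W : Type*} [NormedAddCommGroup W] [NormedSpace ℝ W] {t : ℝ}
    (ht : 1 ≤ t) : ‖dilateSnd W t‖ ≤ t := by
  refine ContinuousLinearMap.opNorm_le_bound _ (by positivity) fun x ↦ ?_
  have h1 := norm_fst_le x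
  have h2 := norm_snd_le x
  simp only [dilateSnd, ContinuousLinearMap.prod_apply, ContinuousLinearMap.coe_fst', _root_.smul_apply,
    ContinuousLinearMap.coe_snd', Prod.norm_def (_, _), norm_smul, Real.norm_of_nonneg (zero_le_one.trans ht)]
  refine max_le (h1.trans (le_mul_of_one_le_left (norm_nonneg _) ht)) (mul_le_mul_of_nonneg_left h2 (by positivity))

/-- Borel's lemma with parameters: there is a smooth function whose Taylor series in the second
variable at `0` is any given formal power series with smooth coefficients. -/
theorem exists_contDiff_forall_flatAt {c : ∀ n, (Fin n → Fin N) → (Fin N → ℝ) → ℝ}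
    (hc : ∀ n a, ContDiff ℝ ∞ (c n a)) (hcs : ∀ n a, HasCompactSupport (c n a)) :
    ∃ T : (Fin N → ℝ) × (Fin N → ℝ) → ℝ, ContDiff ℝ ∞ T ∧ ∀ K z, FlatAt K
      (fun p ↦ T p - ∑ n ∈ Finset.range K, ∑ a, c n a p.1 * ∏ i, p.2 (a i)) (z, 0) := by
  let χ : ContDiffBump (0 : Fin N → ℝ) := ⟨1, 2, by norm_num, by norm_num⟩
  have hχ : ContDiff ℝ ∞ χ := χ.contDiff
  let R (n : ℕ) (p : (Fin N → ℝ) × (Fin N → ℝ)) : ℝ := χ p.2 * ∑ a, c n a p.1 * ∏ i, p.2 (a i)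
  have hcoord (b : Fin N) : ContDiff ℝ ∞ (fun p : (Fin N → ℝ) × (Fin N → ℝ) ↦ p.2 b) :=
    (contDiff_apply ℝ ℝ b).comp contDiff_snd
  have hR (n) : ContDiff ℝ ∞ (R n) :=
    (hχ.comp contDiff_snd).mul (ContDiff.sum fun a _ ↦
      ((hc n a).comp contDiff_fst).mul (contDiff_prod fun i _ ↦ hcoord (a i)))
  have hRc (n) : HasCompactSupport (R n) := by
    refine HasCompactSupport.intro (K := (⋃ a, tsupport (c n a)) ×ˢ tsupport χ)
      ((isCompact_iUnion fun a ↦ hcs n a).prod χ.hasCompactSupport) fun p hp ↦ ?_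
    rw [Set.mem_prod, not_and_or] at hp
    rcases hp with hp | hp
    · have : ∀ a, c n a p.1 = 0 := fun a ↦
        image_eq_zero_of_notMem_tsupport fun h ↦ hp (Set.mem_iUnion.2 ⟨a, h⟩)
      simp [R, this]
    · simp [R, image_eq_zero_of_notMem_tsupport hp]
  choose t ht1 ht using fun n ↦ exists_rescaling (hR n) (hRc n)
    (fun t h ↦ norm_dilateSnd_le (W := Fin N → ℝ) h) n
  let f (n : ℕ) (p : (Fin N → ℝ) × (Fin N → ℝ)) : ℝ := (t n)⁻¹ ^ n * R n (dilateSnd _ (t n) p)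
  have hf (n) : ContDiff ℝ ∞ (f n) := contDiff_const.mul ((hR n).comp (dilateSnd (Fin N → ℝ) (t n)).contDiff)
  -- By homogeneity of degree `n`, the factor `t⁻¹ ^ n` undoes the dilation in the polynomial: only
  -- the cutoff is rescaled, so the Taylor coefficients at `0` are unchanged.
  have hfeq (n) (p) : f n p = χ (t n • p.2) * ∑ a, c n a p.1 * ∏ i, p.2 (a i) := by
    have h0 : t n ≠ 0 := by linarith [ht1 n]
    simp only [f, R, dilateSnd, ContinuousLinearMap.prod_apply, ContinuousLinearMap.coe_fst', _root_.smul_apply,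
      ContinuousLinearMap.coe_snd', Pi.smul_apply, smul_eq_mul, Finset.prod_mul_distrib,
      Finset.prod_const, Finset.card_univ, Fintype.card_fin]
    rw [mul_left_comm, Finset.mul_sum]
    congr 1
    refine Finset.sum_congr rfl fun a _ ↦ ?_
    rw [inv_pow]
    field_simp
  have hflat (z) (n) : FlatAt n (f n) (z, 0) := by
    have : f n = fun p ↦ χ (t n • p.2) * ∑ a, c n a p.1 * ∏ i, p.2 (a i) := funext (hfeq n)
    rw [this]
    have hs (a : Fin n → Fin N) : FlatAt n (fun p : (Fin N → ℝ) × (Fin N → ℝ) ↦ ∏ i, p.2 (a i)) (z, 0) := by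
      have := FlatAt.prod (p := ((z, 0) : (Fin N → ℝ) × (Fin N → ℝ))) Finset.univ (fun i ↦ hcoord (a i)) (fun i ↦ rfl)
      simpa using this
    have hsm (a : Fin n → Fin N) : ContDiff ℝ ∞ (fun p : (Fin N → ℝ) × (Fin N → ℝ) ↦ ∏ i, p.2 (a i)) :=
      contDiff_prod fun i _ ↦ hcoord (a i)
    refine FlatAt.mul_left (hχ.comp (contDiff_snd.const_smul _)) (ContDiff.sum fun a _ ↦
      ((hc _ a).comp contDiff_fst).mul (hsm a)) ?_
    exact FlatAt.sum _ (fun a ↦ ((hc _ a).comp contDiff_fst).mul (hsm a)) fun a ↦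
      FlatAt.mul_left ((hc n a).comp contDiff_fst) (hsm a) (hs a)
  refine ⟨fun p ↦ ∑' n, f n p, contDiff_tsum_of_geometric hf ht, fun K z ↦ ?_⟩
  refine (flatAt_tsum_of_geometric hf ht (hflat z) (K := K)).congr ?_
  -- Near `(z, 0)` the first `K` cutoffs equal `1`, so subtracting the first `K` polynomials leaves
  -- precisely the tail of the series.
  have hone (n : ℕ) : ∀ᶠ p : (Fin N → ℝ) × (Fin N → ℝ) in nhds (z, 0), χ (t n • p.2) = 1 := by
    have hcont : Filter.Tendsto (fun p : (Fin N → ℝ) × (Fin N → ℝ) ↦ t n • p.2) (nhds (z, 0)) (nhds 0) := by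
      have : Continuous (fun p : (Fin N → ℝ) × (Fin N → ℝ) ↦ t n • p.2) := by fun_prop
      simpa using this.tendsto (z, 0)
    exact hcont.eventually χ.eventuallyEq_one
  have hall : ∀ᶠ p : (Fin N → ℝ) × (Fin N → ℝ) in nhds (z, 0), ∀ n ∈ Finset.range K, χ (t n • p.2) = 1 :=
    (Finset.eventually_all _).2 fun n _ ↦ hone n
  filter_upwards [hall] with p hp
  rw [← (summable_of_geometric ht p).sum_add_tsum_nat_add K, eq_sub_iff_add_eq, add_comm]
  congr 1
  refine Finset.sum_congr rfl fun n hn ↦ ?_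
  exact ((hfeq n p).trans (by rw [hp n hn, one_mul])).symm

end Borel

/-! ### Derivatives along vector fields, orders of vanishing, and composition with flat functions.
-/

section Calculus

variable {E : Type*} [NormedAddCommGroup E] [NormedSpace ℝ E]
  {H : Type*} [TopologicalSpace H] {I : ModelWithCorners ℝ E H}
  {M : Type*} [TopologicalSpace M] [ChartedSpace H M]

variable [IsManifold I ∞ M]

/-- Smoothness of a vector field. -/
def SmoothField (X : Π x : M, TangentSpace I x) : Prop :=
  ContMDiff I (I.prod 𝓘(ℝ, E)) ∞ (fun x ↦ (⟨x, X x⟩ : TangentBundle I M))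

omit [IsManifold I ∞ M] in
theorem _root_.ContMDiff.mdiffAt {f : M → ℝ} (hf : ContMDiff I 𝓘(ℝ) ∞ f) (x : M) :
    MDifferentiableAt I 𝓘(ℝ) f x :=
  hf.mdifferentiableAt (by simp)

/-- The derivative of a smooth function of two variables along a vector field in the second
variable is smooth. -/
theorem contMDiff_mvfderiv_snd {F : Type*} [NormedAddCommGroup F] [NormedSpace ℝ F]
    {G : Type*} [TopologicalSpace G] {J : ModelWithCorners ℝ F G}
    {P : Type*} [TopologicalSpace P] [ChartedSpace G P] [IsManifold J ∞ P]
    {f : P → M → ℝ} (hf : ContMDiff (J.prod I) 𝓘(ℝ) ∞ (fun q : P × M ↦ f q.1 q.2))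
    {X : Π x : M, TangentSpace I x} (hX : SmoothField X) :
    ContMDiff (J.prod I) 𝓘(ℝ) ∞ (fun q : P × M ↦ mvfderiv I (f q.1) q.2 (X q.2)) := by
  have : IsManifold I 1 M := .of_le (n := ∞) (by simp)
  have : IsManifold J 1 P := .of_le (n := ∞) (by simp)
  -- The partial derivative is the tangent map of `f` applied to the vector `(0, X)`, a smooth
  -- section over `P × M`.
  have hz : ContMDiff (J.prod I) (J.tangent.prod I.tangent) ∞ (fun q : P × M ↦
      ((⟨q.1, 0⟩, ⟨q.2, X q.2⟩) : TangentBundle J P × TangentBundle I M)) :=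
    ((contMDiff_zeroSection ℝ (TangentSpace J : P → Type _)).comp contMDiff_fst).prodMk
      (hX.comp contMDiff_snd)
  have h1 := (hf.contMDiff_tangentMap (m := ∞) (by simp)).comp
    (contMDiff_equivTangentBundleProd_symm.comp hz)
  have h2 := (contMDiff_snd_tangentBundle_modelSpace ℝ 𝓘(ℝ, ℝ)).comp h1
  refine h2.congr fun q ↦ ?_
  have hm := (hf.mdifferentiableAt (by simp) : MDifferentiableAt _ _ _ q)
  have hd : MDifferentiableAt I (J.prod I) (fun y : M ↦ (q.1, y)) q.2 :=
    mdifferentiableAt_const.prodMk mdifferentiableAt_id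
  refine (mvfderiv_comp_apply (g := fun q : P × M ↦ f q.1 q.2) q.2 hm hd (X q.2)).trans ?_
  have h3 : mfderiv I (J.prod I) (fun y : M ↦ (q.1, y)) q.2 (X q.2) = (0, X q.2) := by
    have := mfderiv_prodMk (x := q.2) (mdifferentiableAt_const (I := I) (I' := J) (c := q.1))
      (mdifferentiableAt_id (I := I))
    refine (congrArg (fun A ↦ A (X q.2)) this).trans ?_
    rw [mfderiv_const, mfderiv_id]
    rfl
  exact congrArg _ h3

theorem SmoothField.contMDiff_mvfderiv {f : M → ℝ} (hf : ContMDiff I 𝓘(ℝ) ∞ f)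
    {X : Π x : M, TangentSpace I x} (hX : SmoothField X) :
    ContMDiff I 𝓘(ℝ) ∞ (fun x ↦ mvfderiv I f x (X x)) :=
  (contMDiff_mvfderiv_snd (f := fun _ : M ↦ f) (J := I) (hf.comp contMDiff_snd) hX).comp
    (contMDiff_id.prodMk contMDiff_id)

theorem contMDiff_mvfderiv_section {f : M → ℝ} (hf : ContMDiff I 𝓘(ℝ) ∞ f) :
    ContMDiff I (I.prod 𝓘(ℝ, E →L[ℝ] ℝ)) ∞
      (fun x ↦ TotalSpace.mk' (E →L[ℝ] ℝ) (E := fun x : M ↦ CotangentSpace I x) x (mvfderiv I f x)) := by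
  have : IsManifold I 1 M := .of_le (n := ∞) (by simp)
  intro x
  have h := (hf x).mfderiv_const (m := ∞) (by simp)
  rw [contMDiffAt_hom_bundle]
  refine ⟨contMDiffAt_id, ?_⟩
  refine h.congr_of_eventuallyEq ?_
  filter_upwards with y
  simp [inTangentCoordinates, ContinuousLinearMap.inCoordinates]
  rfl


/-! ### Order of vanishing at a point -/

variable (I) in
/-- `f` vanishes at `y` together with all its derivatives of order less than `n` along smooth
vector fields. -/
def VanishesTo (y : M) : ℕ → (M → ℝ) → Prop
  | 0, _ => True
  | n + 1, f => f y = 0 ∧ ∀ X : Π x : M, TangentSpace I x, SmoothField X →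
      VanishesTo y n (fun x ↦ mvfderiv I f x (X x))

namespace VanishesTo

variable {y : M} {f g : M → ℝ} {m n : ℕ}

theorem of_succ : ∀ {n : ℕ} {f : M → ℝ}, VanishesTo I y (n + 1) f → VanishesTo I y n f
  | 0, _, _ => trivial
  | _ + 1, _, h => ⟨h.1, fun X hX ↦ of_succ (h.2 X hX)⟩

theorem of_le (h : VanishesTo I y n f) (hmn : m ≤ n) : VanishesTo I y m f := by
  induction hmn with
  | refl => exact h
  | step _ ih => exact ih h.of_succ

theorem eq_zero (h : VanishesTo I y (n + 1) f) : f y = 0 := by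
  cases n <;> exact h.1

theorem add (hf : ContMDiff I 𝓘(ℝ) ∞ f) (hg : ContMDiff I 𝓘(ℝ) ∞ g) (hfn : VanishesTo I y n f)
    (hgn : VanishesTo I y n g) : VanishesTo I y n (fun x ↦ f x + g x) := by
  induction n generalizing f g with
  | zero => trivial
  | succ n ih =>
    refine ⟨by simp [hfn.1, hgn.1], fun X hX ↦ ?_⟩
    have h : (fun x ↦ mvfderiv I (fun x ↦ f x + g x) x (X x)) =
        fun x ↦ mvfderiv I f x (X x) + mvfderiv I g x (X x) := by
      funext x
      rw [mvfderiv_fun_add (hf.mdiffAt x) (hg.mdiffAt x)]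
      rfl
    rw [h]
    exact ih (hX.contMDiff_mvfderiv hf) (hX.contMDiff_mvfderiv hg) (hfn.2 X hX) (hgn.2 X hX)

theorem mul (hf : ContMDiff I 𝓘(ℝ) ∞ f) (hg : ContMDiff I 𝓘(ℝ) ∞ g) (hfn : VanishesTo I y n f)
    (hgm : VanishesTo I y m g) : VanishesTo I y (n + m) (fun x ↦ f x * g x) := by
  -- The induction is on the total order, because each Leibniz term lowers only one of `n` and `m`.
  obtain ⟨s, hs⟩ : ∃ s, s = n + m := ⟨_, rfl⟩
  rw [← hs]
  induction s generalizing f g n m with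
  | zero => trivial
  | succ s ih =>
    refine ⟨?_, fun X hX ↦ ?_⟩
    · rcases n with _ | n
      · obtain ⟨m, rfl⟩ : ∃ k, m = k + 1 := ⟨m - 1, by omega⟩
        simp [hgm.1]
      · simp [hfn.1]
    have h : (fun x ↦ mvfderiv I (fun x ↦ f x * g x) x (X x)) =
        fun x ↦ f x * mvfderiv I g x (X x) + mvfderiv I f x (X x) * g x := by
      funext x
      rw [mvfderiv_fun_mul (hf.mdiffAt x) (hg.mdiffAt x)]
      simp [mul_comm]
    rw [h]
    have hXf := hX.contMDiff_mvfderiv hf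
    have hXg := hX.contMDiff_mvfderiv hg
    refine add (hf.mul hXg) (hXf.mul hg) ?_ ?_
    -- If `m = 0`, nothing is known about `g`, but then `f` alone vanishes to order `s + 1`.
    · rcases m with _ | m
      · exact ih (n := s) (m := 0) hf hXg (hfn.of_le (by omega)) trivial rfl
      · exact ih hf hXg hfn (hgm.2 X hX) (by omega)
    · rcases n with _ | n
      · exact ih (n := 0) (m := s) hXf hg trivial (hgm.of_le (by omega)) (by omega)
      · exact ih hXf hg (hfn.2 X hX) hgm (by omega)

theorem mul_left (hf : ContMDiff I 𝓘(ℝ) ∞ f) (hg : ContMDiff I 𝓘(ℝ) ∞ g)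
    (hgm : VanishesTo I y m g) : VanishesTo I y m (fun x ↦ f x * g x) := by
  simpa using mul (n := 0) hf hg trivial hgm

theorem zero : VanishesTo I y n (fun _ ↦ (0 : ℝ)) := by
  induction n with
  | zero => trivial
  | succ n ih =>
    refine ⟨rfl, fun X hX ↦ ?_⟩
    have h : (fun x ↦ mvfderiv I (fun _ : M ↦ (0 : ℝ)) x (X x)) = fun _ ↦ 0 := by
      funext x
      rw [mvfderiv_const]
      rfl
    rwa [h]

theorem sub (hf : ContMDiff I 𝓘(ℝ) ∞ f) (hg : ContMDiff I 𝓘(ℝ) ∞ g) (hfn : VanishesTo I y n f)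
    (hgn : VanishesTo I y n g) : VanishesTo I y n (fun x ↦ f x - g x) := by
  have h := add hf (contMDiff_const.mul hg) hfn (mul_left (f := fun _ ↦ -1) contMDiff_const hg hgn)
  simpa [sub_eq_add_neg] using h

theorem sum {ι : Type*} (s : Finset ι) {f : ι → M → ℝ} (hf : ∀ i, ContMDiff I 𝓘(ℝ) ∞ (f i))
    (h : ∀ i, VanishesTo I y n (f i)) : VanishesTo I y n (fun x ↦ ∑ i ∈ s, f i x) := by
  classical
  induction s using Finset.induction_on with
  | empty => simpa using zero
  | insert a s ha ih =>
    simp only [Finset.sum_insert ha]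
    exact add (hf a) (contMDiff_finsetSum fun i _ ↦ hf i) (h a) ih

end VanishesTo

/-- The iterated derivative `X (k - 1) (⋯ (X 0 f))`. -/
noncomputable def lieIter (f : M → ℝ) : (k : ℕ) → (Fin k → Π x : M, TangentSpace I x) → M → ℝ
  | 0, _ => f
  | k + 1, X => fun x ↦ mvfderiv I (lieIter f k (Fin.init X)) x (X (Fin.last k) x)

omit [IsManifold I ∞ M] in
-- The definition peels off the outermost derivative; inductions that differentiate the function
-- itself need the innermost one.
theorem lieIter_succ (f : M → ℝ) {k : ℕ} (X : Fin (k + 1) → Π x : M, TangentSpace I x) :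
    lieIter f (k + 1) X = lieIter (fun x ↦ mvfderiv I f x (X 0 x)) k (Fin.tail X) := by
  induction k with
  | zero => rfl
  | succ k ih =>
    rw [lieIter, ih (Fin.init X)]
    rfl

theorem contMDiff_lieIter {f : M → ℝ} (hf : ContMDiff I 𝓘(ℝ) ∞ f) {k : ℕ}
    {X : Fin k → Π x : M, TangentSpace I x} (hX : ∀ i, SmoothField (X i)) :
    ContMDiff I 𝓘(ℝ) ∞ (lieIter f k X) := by
  induction k with
  | zero => exact hf
  | succ k ih => exact (hX _).contMDiff_mvfderiv (ih fun i ↦ hX _)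

theorem lieIter_add {f g : M → ℝ} (hf : ContMDiff I 𝓘(ℝ) ∞ f) (hg : ContMDiff I 𝓘(ℝ) ∞ g) {k : ℕ}
    {X : Fin k → Π x : M, TangentSpace I x} (hX : ∀ i, SmoothField (X i)) :
    lieIter (fun x ↦ f x + g x) k X = fun x ↦ lieIter f k X x + lieIter g k X x := by
  induction k with
  | zero => rfl
  | succ k ih =>
    funext x
    have hi : ∀ i, SmoothField (Fin.init X i) := fun i ↦ hX _
    have h := mvfderiv_fun_add ((contMDiff_lieIter hf hi).mdiffAt x)
      ((contMDiff_lieIter hg hi).mdiffAt x)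
    rw [lieIter, ih hi]
    exact congrArg (fun A ↦ A (X (Fin.last k) x)) h

theorem VanishesTo.lieIter {f : M → ℝ} {y : M} {m k : ℕ}
    {X : Fin k → Π x : M, TangentSpace I x} (hX : ∀ i, SmoothField (X i))
    (h : VanishesTo I y (m + k) f) : VanishesTo I y m (lieIter f k X) := by
  induction k generalizing m with
  | zero => exact h
  | succ k ih =>
    have h' : VanishesTo I y (m + 1 + k) f := by rwa [add_right_comm]
    exact (ih (X := Fin.init X) (fun i ↦ hX _) h').2 _ (hX _)

section Composition

variable {V : Type*} [NormedAddCommGroup V] [NormedSpace ℝ V] {ι : Type*} [Fintype ι]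

omit [IsManifold I ∞ M] in
theorem mvfderiv_comp_basis (b : Module.Basis ι ℝ V) {r : V → ℝ} (hr : ContDiff ℝ ∞ r)
    {ψ : M → V} (hψ : ContMDiff I 𝓘(ℝ, V) ∞ ψ) (x : M) (w : TangentSpace I x) :
    mvfderiv I (fun x ↦ r (ψ x)) x w =
      ∑ j, fderiv ℝ r (ψ x) (b j) * mvfderiv I (fun x ↦ b.repr (ψ x) j) x w := by
  have : FiniteDimensional ℝ V := b.finiteDimensional_of_finite
  have hψx : MDifferentiableAt I 𝓘(ℝ, V) ψ x := hψ.mdifferentiableAt (by simp)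
  have key {s : V → ℝ} (hs : DifferentiableAt ℝ s (ψ x)) :
      mvfderiv I (fun x ↦ s (ψ x)) x w = fderiv ℝ s (ψ x) (mvfderiv I ψ x w) := by
    refine (mvfderiv_comp_apply (I := 𝓘(ℝ, V)) x hs.mdifferentiableAt hψx w).trans ?_
    rw [mvfderiv, mfderiv_eq_fderiv]
    rfl
  rw [key (hr.differentiable (by simp) _)]
  conv_lhs => rw [← b.sum_repr (mvfderiv I ψ x w), map_sum]
  refine Finset.sum_congr rfl fun j _ ↦ ?_
  have h := key (s := (LinearMap.toContinuousLinearMap (b.coord j))) (by fun_prop)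
  rw [ContinuousLinearMap.fderiv] at h
  rw [map_smul, smul_eq_mul, mul_comm]
  congr 1
  exact h.symm

omit [IsManifold I ∞ M] in
theorem contMDiff_repr (b : Module.Basis ι ℝ V) {ψ : M → V} (hψ : ContMDiff I 𝓘(ℝ, V) ∞ ψ) (j : ι) :
    ContMDiff I 𝓘(ℝ) ∞ (fun x ↦ b.repr (ψ x) j) := by
  have : FiniteDimensional ℝ V := b.finiteDimensional_of_finite
  exact (LinearMap.toContinuousLinearMap (b.coord j)).contDiff.contMDiff.comp hψ

theorem FlatAt.fderiv_apply {n : ℕ} {r : V → ℝ} {p : V} (hr : ContDiff ℝ ∞ r)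
    (h : FlatAt (n + 1) r p) (v : V) : FlatAt n (fun u ↦ fderiv ℝ r u v) p := by
  intro j hj
  have h1 := (ContinuousLinearMap.apply ℝ ℝ v).iteratedFDeriv_comp_left (x := p) (i := j) (n := ∞)
    (f := fderiv ℝ r) ((hr.fderiv_right (m := ∞) (by simp)).contDiffAt) (by exact_mod_cast le_top)
  have h2 := h (j + 1) (by omega)
  ext m
  have h3 := congrArg (fun A ↦ A m) h1
  refine h3.trans ?_
  have h4 := iteratedFDeriv_succ_apply_right (𝕜 := ℝ) (f := r) (x := p) (n := j)
    (Fin.snoc (α := fun _ ↦ V) m v)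
  simp only [h2, Fin.init_snoc, Fin.snoc_last] at h4
  exact h4.symm

theorem iteratedFDeriv_fderiv_apply {n : ℕ} {r : V → ℝ} {p : V} (hr : ContDiff ℝ ∞ r)
    (m : Fin (n + 1) → V) : iteratedFDeriv ℝ n (fun u ↦ fderiv ℝ r u (m (Fin.last n))) p (Fin.init m)
      = iteratedFDeriv ℝ (n + 1) r p m := by
  have h1 := (ContinuousLinearMap.apply ℝ ℝ (m (Fin.last n))).iteratedFDeriv_comp_left (x := p)
    (i := n) (n := ∞) (f := fderiv ℝ r) ((hr.fderiv_right (m := ∞) (by simp)).contDiffAt)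
    (by exact_mod_cast le_top)
  rw [iteratedFDeriv_succ_apply_right]
  exact congrArg (fun A ↦ A (Fin.init m)) h1

theorem contDiff_fderiv_apply {r : V → ℝ} (hr : ContDiff ℝ ∞ r) (v : V) :
    ContDiff ℝ ∞ (fun u ↦ fderiv ℝ r u v) :=
  (hr.fderiv_right (m := ∞) (by simp)).clm_apply contDiff_const

/-- By the chain rule a derivative of `r ∘ ψ` is a combination, with smooth coefficients, of
functions `(∂_j r) ∘ ψ`, and `∂_j r` is flat to one order less. -/
theorem FlatAt.vanishesTo [FiniteDimensional ℝ V] {n : ℕ} {r : V → ℝ} (hr : ContDiff ℝ ∞ r)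
    {ψ : M → V} (hψ : ContMDiff I 𝓘(ℝ, V) ∞ ψ) {y : M} (h : FlatAt n r (ψ y)) :
    VanishesTo I y n (fun x ↦ r (ψ x)) := by
  induction n generalizing r with
  | zero => trivial
  | succ n ih =>
    have h0 := congrArg (fun A ↦ A 0) (h 0 (by omega))
    refine ⟨by simpa using h0, fun X hX ↦ ?_⟩
    simp only [mvfderiv_comp_basis (Module.finBasis ℝ V) hr hψ]
    have h1 (j) := hX.contMDiff_mvfderiv (contMDiff_repr (Module.finBasis ℝ V) hψ j)
    have h2 (j) := contDiff_fderiv_apply hr (Module.finBasis ℝ V j)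
    have h3 (j) : ContMDiff I 𝓘(ℝ) ∞ (fun x ↦ fderiv ℝ r (ψ x) (Module.finBasis ℝ V j)) :=
      (h2 j).contMDiff.comp hψ
    refine VanishesTo.sum _ (fun j ↦ (h3 j).mul (h1 j)) fun j ↦ ?_
    simpa using VanishesTo.mul (m := 0) (h3 j) (h1 j) (ih (h2 j) (h.fderiv_apply hr _)) trivial

/-- The leading derivative of a composition with a flat function. -/
theorem lieIter_comp_of_flatAt (b : Module.Basis ι ℝ V) {k : ℕ} {r : V → ℝ}
    (hr : ContDiff ℝ ∞ r) {ψ : M → V} (hψ : ContMDiff I 𝓘(ℝ, V) ∞ ψ) {y : M}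
    (h : FlatAt k r (ψ y)) {X : Fin k → Π x : M, TangentSpace I x} (hX : ∀ i, SmoothField (X i)) :
    lieIter (fun x ↦ r (ψ x)) k X y = iteratedFDeriv ℝ k r (ψ y)
      (fun i ↦ ∑ j, mvfderiv I (fun x ↦ b.repr (ψ x) j) y (X i.rev y) • b j) := by
  have : FiniteDimensional ℝ V := b.finiteDimensional_of_finite
  induction k generalizing r with
  | zero => simp [lieIter]
  | succ k ih =>
    have htail : ∀ i, SmoothField (Fin.tail X i) := fun i ↦ hX _
    set c : ι → ℝ := fun j ↦ mvfderiv I (fun x ↦ b.repr (ψ x) j) y (X 0 y) with hc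
    set v := ∑ j, c j • b j with hv
    have h1 (j) := (hX 0).contMDiff_mvfderiv (contMDiff_repr b hψ j)
    have h2 (j) := contDiff_fderiv_apply hr (b j)
    have h3 (j) : ContMDiff I 𝓘(ℝ) ∞ (fun x ↦ fderiv ℝ r (ψ x) (b j)) := (h2 j).contMDiff.comp hψ
    have h4 (j) : ContMDiff I 𝓘(ℝ) ∞
        (fun x ↦ mvfderiv I (fun x ↦ b.repr (ψ x) j) x (X 0 x) - c j) := (h1 j).sub contMDiff_const
    have hsplit : (fun x ↦ mvfderiv I (fun x ↦ r (ψ x)) x (X 0 x)) = fun x ↦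
        fderiv ℝ r (ψ x) v + ∑ j, fderiv ℝ r (ψ x) (b j) *
          (mvfderiv I (fun x ↦ b.repr (ψ x) j) x (X 0 x) - c j) := by
      funext x
      rw [mvfderiv_comp_basis b hr hψ, hv, map_sum, ← Finset.sum_add_distrib]
      refine Finset.sum_congr rfl fun j _ ↦ ?_
      rw [map_smul, smul_eq_mul]
      ring
    -- Freezing the chain rule coefficients at `y` is harmless: the error is a factor flat to order
    -- `k` times one vanishing at `y`, and only `k` derivatives remain.
    have hvan : VanishesTo I y (1 + k) (fun x ↦ ∑ j, fderiv ℝ r (ψ x) (b j) *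
        (mvfderiv I (fun x ↦ b.repr (ψ x) j) x (X 0 x) - c j)) := by
      refine VanishesTo.sum _ (fun j ↦ (h3 j).mul (h4 j)) fun j ↦ ?_
      rw [add_comm]
      exact VanishesTo.mul (h3 j) (h4 j) ((h.fderiv_apply hr _).vanishesTo (h2 j) hψ)
        ⟨by simp [hc], fun _ _ ↦ trivial⟩
    have h5 : ContMDiff I 𝓘(ℝ) ∞ (fun x ↦ fderiv ℝ r (ψ x) v) :=
      (contDiff_fderiv_apply hr v).contMDiff.comp hψ
    have h6 : ContMDiff I 𝓘(ℝ) ∞ (fun x ↦ ∑ j, fderiv ℝ r (ψ x) (b j) *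
        (mvfderiv I (fun x ↦ b.repr (ψ x) j) x (X 0 x) - c j)) :=
      contMDiff_finsetSum fun j _ ↦ (h3 j).mul (h4 j)
    rw [lieIter_succ, hsplit, lieIter_add h5 h6 htail]
    beta_reduce
    rw [(VanishesTo.lieIter htail hvan).eq_zero, add_zero,
      ih (contDiff_fderiv_apply hr v) (h.fderiv_apply hr v) htail]
    rw [← iteratedFDeriv_fderiv_apply hr]
    -- `X 0`, applied first, fills the last slot of `iteratedFDeriv`; hence the reversal of the
    -- arguments.
    simp only [Fin.rev_last]
    congr 1
    funext i
    simp [Fin.init, Fin.tail, Fin.rev_castSucc]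

end Composition

end Calculus

/-! ### Dual frames and iterated covariant derivatives. -/

section Frames

variable {E : Type*} [NormedAddCommGroup E] [NormedSpace ℝ E]
  {H : Type*} [TopologicalSpace H] {I : ModelWithCorners ℝ E H}
  {M : Type*} [TopologicalSpace M] [ChartedSpace H M] [IsManifold I ∞ M]

/-- Smooth functions `h a` and smooth vector fields `Z a` with `w = ∑ a, dh a (w) • Z a` for all
tangent vectors `w`. -/
structure IsDualFrame {N : ℕ} (h : M → Fin N → ℝ) (Z : Fin N → Π x : M, TangentSpace I x) :
    Prop where
  contMDiff : ContMDiff I 𝓘(ℝ, Fin N → ℝ) ∞ h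
  smoothField : ∀ a, SmoothField (Z a)
  sum_smul : ∀ (x : M) (w : TangentSpace I x), ∑ a, mvfderiv I (fun y ↦ h y a) x w • Z a x = w

theorem SmoothField.update {k : ℕ} {X : Fin k → Π x : M, TangentSpace I x}
    (hX : ∀ i, SmoothField (X i)) (i : Fin k) {Y : Π x : M, TangentSpace I x} (hY : SmoothField Y)
    (j : Fin k) : SmoothField (Function.update X i Y j) := by
  rcases eq_or_ne j i with rfl | hj
  · simpa using hY
  · simpa [hj] using hX j

theorem SmoothField.mdiffAt {X : Π x : M, TangentSpace I x} (hX : SmoothField X) (x : M) :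
    MDifferentiableAt I (I.prod 𝓘(ℝ, E)) (fun x ↦ (⟨x, X x⟩ : TangentBundle I M)) x :=
  ContMDiff.mdifferentiableAt hX (by simp)

namespace IsDualFrame

variable {N : ℕ} {h : M → Fin N → ℝ} {Z : Fin N → Π x : M, TangentSpace I x}

theorem contMDiff_apply (hF : IsDualFrame h Z) (a : Fin N) :
    ContMDiff I 𝓘(ℝ) ∞ (fun x ↦ h x a) :=
  contMDiff_pi_space.1 hF.contMDiff a

/-- `X = ∑ a, dh_a(X) Z_a`. This suits fields such as `∇_Y X`, which are known only through their
pairings with 1-forms. -/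
theorem smoothField_of_contMDiff (hF : IsDualFrame h Z) {X : Π x : M, TangentSpace I x}
    (hX : ∀ a, ContMDiff I 𝓘(ℝ) ∞ (fun x ↦ mvfderiv I (fun y ↦ h y a) x (X x))) :
    SmoothField X := by
  have h1 := ContMDiff.sum_section (s := Finset.univ) (V := fun x : M ↦ TangentSpace I x) (F := E)
    (fun a _ ↦ (hX a).smul_section (hF.smoothField a))
  refine ContMDiff.congr h1 fun x ↦ ?_
  congr 1
  simpa using (hF.sum_smul x (X x)).symm

theorem multilinear_apply (hF : IsDualFrame h Z) {x : M} {k : ℕ}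
    (Φ : MultilinearMap ℝ (fun _ : Fin k ↦ TangentSpace I x) ℝ) (ξ : Fin k → TangentSpace I x) :
    Φ ξ = ∑ a : Fin k → Fin N, (∏ i, mvfderiv I (fun y ↦ h y (a i)) x (ξ i)) *
      Φ (fun i ↦ Z (a i) x) := by
  conv_lhs => rw [show ξ = fun i ↦ ∑ b, mvfderiv I (fun y ↦ h y b) x (ξ i) • Z b x from
    funext fun i ↦ (hF.sum_smul x (ξ i)).symm, MultilinearMap.map_sum]
  refine Finset.sum_congr rfl fun a _ ↦ ?_
  rw [MultilinearMap.map_smul_univ, smul_eq_mul]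

end IsDualFrame

omit [IsManifold I ∞ M] in
theorem mvfderiv_prod {ι : Type*} [DecidableEq ι] (s : Finset ι) {u : ι → M → ℝ}
    (hu : ∀ i, ContMDiff I 𝓘(ℝ) ∞ (u i)) (x : M) (w : TangentSpace I x) :
    mvfderiv I (fun x ↦ ∏ i ∈ s, u i x) x w =
      ∑ i ∈ s, ∏ j ∈ s, Function.update (fun j ↦ u j x) i (mvfderiv I (u i) x w) j := by
  induction s using Finset.induction_on with
  | empty => simp [mvfderiv_const]
  | insert a s ha ih =>
    simp only [Finset.prod_insert ha, Finset.sum_insert ha]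
    have h1 := mvfderiv_fun_mul ((hu a).mdiffAt x)
      ((contMDiff_finsetProd (t := s) fun i _ ↦ hu i).mdiffAt x)
    rw [h1]
    simp only [_root_.add_apply, _root_.smul_apply, smul_eq_mul, ih, Function.update_self]
    rw [add_comm, mul_comm, Finset.mul_sum]
    congr 1
    · congr 1
      refine Finset.prod_congr rfl fun j hj ↦ ?_
      rw [Function.update_of_ne (by rintro rfl; exact ha hj)]
    · refine Finset.sum_congr rfl fun i hi ↦ ?_
      rw [Function.update_of_ne (by rintro rfl; exact ha hi)]

omit [IsManifold I ∞ M] in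
theorem mvfderiv_sum {ι : Type*} (s : Finset ι) {u : ι → M → ℝ}
    (hu : ∀ i, ContMDiff I 𝓘(ℝ) ∞ (u i)) (x : M) (w : TangentSpace I x) :
    mvfderiv I (fun x ↦ ∑ i ∈ s, u i x) x w = ∑ i ∈ s, mvfderiv I (u i) x w := by
  classical
  induction s using Finset.induction_on with
  | empty => simp [mvfderiv_const]
  | insert a s ha ih =>
    simp only [Finset.sum_insert ha]
    have h1 := mvfderiv_fun_add ((hu a).mdiffAt x)
      ((contMDiff_finsetSum (t := s) fun i _ ↦ hu i).mdiffAt x)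
    rw [h1, _root_.add_apply, ih]

section Connection

variable [FiniteDimensional ℝ E]
  {cov : CovariantDerivative I (E →L[ℝ] ℝ) (fun x : M ↦ CotangentSpace I x)}
  [hcov : CovariantDerivative.ContMDiffCovariantDerivative cov ∞]
  {N : ℕ} {h : M → Fin N → ℝ} {Z : Fin N → Π x : M, TangentSpace I x}

omit [FiniteDimensional ℝ E] in
include hcov in
theorem contMDiff_cov_apply {f : M → ℝ} (hf : ContMDiff I 𝓘(ℝ) ∞ f)
    {X Y : Π x : M, TangentSpace I x} (hX : SmoothField X) (hY : SmoothField Y) :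
    ContMDiff I 𝓘(ℝ) ∞ (fun x ↦ cov (mvfderiv I f) x (Y x) (X x)) := by
  have h1 := hcov.contMDiff.contMDiff (σ := mvfderiv I f)
    ((contMDiff_mvfderiv_section hf).contMDiffOn)
  rw [contMDiffOn_univ] at h1
  have h2 := ContMDiff.clm_bundle_apply₂ (F₁ := E) (F₂ := E) (F₃ := ℝ)
      (E₁ := fun y : M ↦ TangentSpace I y) (E₂ := fun y : M ↦ TangentSpace I y)
      (E₃ := Bundle.Trivial M ℝ) (b := fun y ↦ y) h1 hY hX
  intro x
  have h3 := h2 x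
  rw [contMDiffAt_totalSpace] at h3
  exact h3.2

omit hcov in
theorem mvfderiv_dualConnection {f : M → ℝ} (hf : ContMDiff I 𝓘(ℝ) ∞ f)
    {X : Π x : M, TangentSpace I x} (hX : SmoothField X) (x : M) (w : TangentSpace I x) :
    mvfderiv I f x (dualConnection cov X x w) =
      mvfderiv I (fun y ↦ mvfderiv I f y (X y)) x w - cov (mvfderiv I f) x w (X x) :=
  cotangent_dualConnection_apply cov (θ := mvfderiv I f) (hX.mdiffAt x)
    ((contMDiff_mvfderiv_section hf).mdifferentiableAt (by simp)) w

include hcov in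
-- The recursion for `∇ᵏ` feeds `∇_Y X` back in as an argument, so every later induction over smooth
-- fields depends on this.
theorem IsDualFrame.smoothField_dualConnection (hF : IsDualFrame h Z)
    {X Y : Π x : M, TangentSpace I x} (hX : SmoothField X) (hY : SmoothField Y) :
    SmoothField (fun x ↦ dualConnection cov X x (Y x)) := by
  refine hF.smoothField_of_contMDiff fun a ↦ ?_
  have ha := hF.contMDiff_apply a
  simp only [mvfderiv_dualConnection ha hX]
  exact (hY.contMDiff_mvfderiv (hX.contMDiff_mvfderiv ha)).sub (contMDiff_cov_apply ha hX hY)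

include hcov in
-- The parameter in `P` serves for functions `F y`: restricting to the diagonal then shows that the
-- Taylor coefficients are smooth in `y`.
theorem IsDualFrame.contMDiff_iteratedCovDeriv_snd (hF : IsDualFrame h Z)
    {F : Type*} [NormedAddCommGroup F] [NormedSpace ℝ F]
    {G : Type*} [TopologicalSpace G] {J : ModelWithCorners ℝ F G}
    {P : Type*} [TopologicalSpace P] [ChartedSpace G P] [IsManifold J ∞ P]
    {f : P → M → ℝ} (hf : ContMDiff (J.prod I) 𝓘(ℝ) ∞ (fun q : P × M ↦ f q.1 q.2))
    {k : ℕ} {X : Fin k → Π x : M, TangentSpace I x} (hX : ∀ i, SmoothField (X i)) :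
    ContMDiff (J.prod I) 𝓘(ℝ) ∞ (fun q : P × M ↦ iteratedCovDeriv cov (f q.1) k X q.2) := by
  induction k with
  | zero => exact hf
  | succ k ih =>
    have hi : ∀ i, SmoothField (Fin.init X i) := fun i ↦ hX _
    exact (contMDiff_mvfderiv_snd (f := fun p ↦ iteratedCovDeriv cov (f p) k (Fin.init X))
      (ih hi) (hX (Fin.last k))).sub (contMDiff_finsetSum fun i _ ↦
        ih (SmoothField.update hi i (hF.smoothField_dualConnection (hi i) (hX (Fin.last k)))))

variable {f g : M → ℝ}

include hcov in
theorem IsDualFrame.contMDiff_iteratedCovDeriv (hF : IsDualFrame h Z)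
    (hf : ContMDiff I 𝓘(ℝ) ∞ f) {k : ℕ} {X : Fin k → Π x : M, TangentSpace I x}
    (hX : ∀ i, SmoothField (X i)) : ContMDiff I 𝓘(ℝ) ∞ (iteratedCovDeriv cov f k X) :=
  (hF.contMDiff_iteratedCovDeriv_snd (J := I) (f := fun _ : M ↦ f) (hf.comp contMDiff_snd) hX).comp
    (contMDiff_id.prodMk contMDiff_id)

include hcov in
theorem IsDualFrame.iteratedCovDeriv_add (hF : IsDualFrame h Z)
    (hf : ContMDiff I 𝓘(ℝ) ∞ f) (hg : ContMDiff I 𝓘(ℝ) ∞ g) {k : ℕ}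
    {X : Fin k → Π x : M, TangentSpace I x} (hX : ∀ i, SmoothField (X i)) (x : M) :
    iteratedCovDeriv cov (fun x ↦ f x + g x) k X x =
      iteratedCovDeriv cov f k X x + iteratedCovDeriv cov g k X x := by
  induction k generalizing x with
  | zero => rfl
  | succ k ih =>
    have hi : ∀ i, SmoothField (Fin.init X i) := fun i ↦ hX _
    have hu (i) := SmoothField.update hi i
      (hF.smoothField_dualConnection (cov := cov) (hi i) (hX (Fin.last k)))
    have h1 := mvfderiv_fun_add ((hF.contMDiff_iteratedCovDeriv (cov := cov) hf hi).mdiffAt x)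
      ((hF.contMDiff_iteratedCovDeriv (cov := cov) hg hi).mdiffAt x)
    have h2 : iteratedCovDeriv cov (fun x ↦ f x + g x) k (Fin.init X) = fun x ↦
      iteratedCovDeriv cov f k (Fin.init X) x + iteratedCovDeriv cov g k (Fin.init X) x :=
      funext fun x ↦ ih hi x
    simp only [iteratedCovDeriv, h2, h1, ih (hu _), Finset.sum_add_distrib, _root_.add_apply]
    ring

include hcov in
theorem IsDualFrame.iteratedCovDeriv_const_mul (hF : IsDualFrame h Z)
    (hf : ContMDiff I 𝓘(ℝ) ∞ f) (c : ℝ) {k : ℕ}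
    {X : Fin k → Π x : M, TangentSpace I x} (hX : ∀ i, SmoothField (X i)) (x : M) :
    iteratedCovDeriv cov (fun x ↦ c * f x) k X x = c * iteratedCovDeriv cov f k X x := by
  induction k generalizing x with
  | zero => rfl
  | succ k ih =>
    have hi : ∀ i, SmoothField (Fin.init X i) := fun i ↦ hX _
    have hu (i) := SmoothField.update hi i
      (hF.smoothField_dualConnection (cov := cov) (hi i) (hX (Fin.last k)))
    have h1 := mvfderiv_fun_mul (mdifferentiableAt_const (I := I) (I' := 𝓘(ℝ)) (c := c))
      ((hF.contMDiff_iteratedCovDeriv (cov := cov) hf hi).mdiffAt x)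
    have h2 : iteratedCovDeriv cov (fun x ↦ c * f x) k (Fin.init X) = fun x ↦
      c * iteratedCovDeriv cov f k (Fin.init X) x := funext fun x ↦ ih hi x
    simp only [iteratedCovDeriv, h2, h1, ih (hu _), mvfderiv_const, ← Finset.mul_sum]
    simp
    ring

include hcov in
/-- The leading part of the iterated covariant derivative is the iterated Lie derivative. -/
theorem IsDualFrame.vanishesTo_iteratedCovDeriv (hF : IsDualFrame h Z)
    (hf : ContMDiff I 𝓘(ℝ) ∞ f) {y : M} {m k : ℕ} (hv : VanishesTo I y (m + k) f)
    {X : Fin k → Π x : M, TangentSpace I x} (hX : ∀ i, SmoothField (X i)) :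
    VanishesTo I y m (iteratedCovDeriv cov f k X) ∧
      VanishesTo I y (m + 1) (fun x ↦ iteratedCovDeriv cov f k X x - lieIter f k X x) := by
  induction k generalizing m with
  | zero => exact ⟨hv, by simpa [iteratedCovDeriv, lieIter] using VanishesTo.zero⟩
  | succ k ih =>
    have hi : ∀ i, SmoothField (Fin.init X i) := fun i ↦ hX _
    have hu (i) := SmoothField.update hi i
      (hF.smoothField_dualConnection (cov := cov) (hi i) (hX (Fin.last k)))
    -- Regrouping `m + (k + 1)` as `(m + 1) + k` gains one order for every expression in `∇ᵏ f`; the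
    -- connection terms are of this kind, hence negligible.
    have hv' : VanishesTo I y (m + 1 + k) f := by rwa [add_right_comm]
    obtain ⟨h1, h2⟩ := ih hv' hi
    have hA := hF.contMDiff_iteratedCovDeriv (cov := cov) hf hi
    have hB := contMDiff_lieIter hf hi
    have hU (i) := hF.contMDiff_iteratedCovDeriv (cov := cov) hf (hu i)
    have hsum := contMDiff_finsetSum (t := Finset.univ) fun i _ ↦ hU i
    have hvs : VanishesTo I y (m + 1) (fun x ↦ ∑ i : Fin k, iteratedCovDeriv cov f k
        (Function.update (Fin.init X) i
          (fun y ↦ dualConnection cov (Fin.init X i) y (X (Fin.last k) y))) x) :=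
      VanishesTo.sum _ hU fun i ↦ (ih hv' (hu i)).1
    have hd := (hX (Fin.last k)).contMDiff_mvfderiv hA
    refine ⟨VanishesTo.sub hd hsum (h1.2 _ (hX _)) hvs.of_succ, ?_⟩
    have hd' := h2.2 _ (hX (Fin.last k))
    have hs := VanishesTo.sub ((hX (Fin.last k)).contMDiff_mvfderiv (hA.sub hB)) hsum hd' hvs
    refine cast (congrArg (VanishesTo I y (m + 1)) (funext fun x ↦ ?_)) hs
    have h3 := mvfderiv_fun_sub (hA.mdiffAt x) (hB.mdiffAt x)
    simp only [iteratedCovDeriv, lieIter, h3, _root_.sub_apply]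
    ring

include hcov in
/-- The iterated covariant derivative is a tensor field. -/
theorem IsDualFrame.exists_multilinearMap (hF : IsDualFrame h Z)
    (hf : ContMDiff I 𝓘(ℝ) ∞ f) (k : ℕ) (x : M) :
    ∃ Φ : MultilinearMap ℝ (fun _ : Fin k ↦ TangentSpace I x) ℝ,
      ∀ X : Fin k → Π x : M, TangentSpace I x, (∀ i, SmoothField (X i)) →
        iteratedCovDeriv cov f k X x = Φ (fun i ↦ X i x) := by
  induction k generalizing x with
  | zero => exact ⟨MultilinearMap.constOfIsEmpty ℝ _ (f x), fun X _ ↦ rfl⟩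
  | succ k ih =>
    let dh (b : Fin N) (x : M) : TangentSpace I x →ₗ[ℝ] ℝ := mvfderiv I (fun y ↦ h y b) x
    let τ (a : Fin k → Fin N) : M → ℝ := iteratedCovDeriv cov f k (fun i ↦ Z (a i))
    have hτ (a) : ContMDiff I 𝓘(ℝ) ∞ (τ a) :=
      hF.contMDiff_iteratedCovDeriv hf fun i ↦ hF.smoothField _
    have hexp (X : Fin k → Π x : M, TangentSpace I x) (hX : ∀ i, SmoothField (X i)) (x : M) :
        iteratedCovDeriv cov f k X x = ∑ a : Fin k → Fin N, (∏ i, dh (a i) x (X i x)) * τ a x := by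
      obtain ⟨Φ, hΦ⟩ := ih x
      rw [hΦ X hX, hF.multilinear_apply Φ]
      refine Finset.sum_congr rfl fun a _ ↦ ?_
      simp only [τ, hΦ _ fun i ↦ hF.smoothField (a i)]
      rfl
    let C (b c : Fin N) : TangentSpace I x →ₗ[ℝ] ℝ :=
      { toFun := fun w ↦ cov (mvfderiv I fun y ↦ h y b) x w (Z c x)
        map_add' := fun v w ↦ by simp
        map_smul' := fun r w ↦ by simp }
    -- Expanding `∇ dh_b` in the forms `dh_c` turns every term into a product of linear forms in the
    -- separate arguments.
    have hC (b : Fin N) (v w : TangentSpace I x) :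
        cov (mvfderiv I fun y ↦ h y b) x w v = ∑ c, dh c x v * C b c w := by
      conv_lhs => rw [← hF.sum_smul x v, map_sum]
      refine Finset.sum_congr rfl fun c _ ↦ ?_
      rw [map_smul]
      rfl
    let Pr (ℓ : Fin (k + 1) → TangentSpace I x →ₗ[ℝ] ℝ) :
        MultilinearMap ℝ (fun _ : Fin (k + 1) ↦ TangentSpace I x) ℝ :=
      (MultilinearMap.mkPiAlgebra ℝ (Fin (k + 1)) ℝ).compLinearMap ℓ
    -- This is `∇(∑ a, τ_a dh_{a 1} ⊗ ⋯ ⊗ dh_{a k})` by the Leibniz rule: first the terms with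
    -- `dτ_a`, then those with some `∇ dh_{a i}`.
    let Φ : MultilinearMap ℝ (fun _ : Fin (k + 1) ↦ TangentSpace I x) ℝ :=
      ∑ a : Fin k → Fin N, (Pr (Fin.snoc (α := fun _ ↦ TangentSpace I x →ₗ[ℝ] ℝ)
          (fun i ↦ dh (a i) x) (mvfderiv I (τ a) x : TangentSpace I x →ₗ[ℝ] ℝ)) +
        τ a x • ∑ i, ∑ c, Pr (Fin.snoc (α := fun _ ↦ TangentSpace I x →ₗ[ℝ] ℝ)
          (Function.update (fun j ↦ dh (a j) x) i (dh c x)) (C (a i) c)))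
    refine ⟨Φ, fun X hX ↦ ?_⟩
    have hi : ∀ i, SmoothField (Fin.init X i) := fun i ↦ hX _
    have hu (i) := SmoothField.update hi i
      (hF.smoothField_dualConnection (cov := cov) (hi i) (hX (Fin.last k)))
    set w := X (Fin.last k) x with hw
    let u (a : Fin k → Fin N) (i : Fin k) (x : M) : ℝ := dh (a i) x (Fin.init X i x)
    have hus (a i) : ContMDiff I 𝓘(ℝ) ∞ (u a i) :=
      (hi i).contMDiff_mvfderiv (hF.contMDiff_apply (a i))
    have hD : mvfderiv I (iteratedCovDeriv cov f k (Fin.init X)) x w =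
        ∑ a, ((∏ i, u a i x) * mvfderiv I (τ a) x w + τ a x * ∑ i, ∏ j,
          Function.update (fun j ↦ u a j x) i (mvfderiv I (u a i) x w) j) := by
      have hus' (a) : ContMDiff I 𝓘(ℝ) ∞ (fun x ↦ (∏ i, u a i x) * τ a x) :=
        (contMDiff_finsetProd fun i _ ↦ hus a i).mul (hτ a)
      rw [show iteratedCovDeriv cov f k (Fin.init X) = fun x ↦ ∑ a, (∏ i, u a i x) * τ a x from
        funext (hexp _ hi), mvfderiv_sum _ hus']
      refine Finset.sum_congr rfl fun a _ ↦ ?_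
      have h1 := mvfderiv_fun_mul ((contMDiff_finsetProd (t := Finset.univ)
        fun i _ ↦ hus a i).mdiffAt x) ((hτ a).mdiffAt x)
      rw [h1, ← mvfderiv_prod _ (hus a)]
      simp
    have hS (i : Fin k) : iteratedCovDeriv cov f k (Function.update (Fin.init X) i
        (fun y ↦ dualConnection cov (Fin.init X i) y (X (Fin.last k) y))) x =
        ∑ a, τ a x * (∏ j, Function.update (fun j ↦ u a j x) i (mvfderiv I (u a i) x w) j -
          ∑ c, ∏ j, Function.update (fun j ↦ u a j x) i (dh c x (Fin.init X i x) * C (a i) c w) j) := by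
      rw [hexp _ (hu i)]
      refine Finset.sum_congr rfl fun a _ ↦ ?_
      rw [mul_comm]
      congr 1
      have h1 : (fun j ↦ dh (a j) x (Function.update (Fin.init X) i
          (fun y ↦ dualConnection cov (Fin.init X i) y (X (Fin.last k) y)) j x)) =
          Function.update (fun j ↦ u a j x) i (mvfderiv I (u a i) x w -
            cov (mvfderiv I fun y ↦ h y (a i)) x w (Fin.init X i x)) := by
        funext j
        rcases eq_or_ne j i with rfl | hj
        · simp only [Function.update_self]
          exact mvfderiv_dualConnection (hF.contMDiff_apply (a j)) (hi j) x w
        · simp [hj, u]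
      rw [h1, hC]
      simp only [Finset.prod_update_of_mem (Finset.mem_univ i), sub_mul, Finset.sum_mul]
    rw [iteratedCovDeriv]
    beta_reduce
    rw [← hw, hD, Finset.sum_congr rfl fun i _ ↦ hS i, Finset.sum_comm,
      ← Finset.sum_sub_distrib]
    simp only [Φ, _root_.sum_apply, _root_.add_apply, _root_.smul_apply]
    refine Finset.sum_congr rfl fun a _ ↦ ?_
    simp only [Pr, MultilinearMap.compLinearMap_apply, MultilinearMap.mkPiAlgebra_apply,
      Fin.prod_univ_castSucc, Fin.snoc_castSucc, Fin.snoc_last, ← Finset.mul_sum,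
      Finset.sum_sub_distrib, smul_eq_mul]
    -- The terms that differentiate `dh_{a i}(X_i)`, the only ones not tensorial in `X_i`, cancel
    -- against those coming from `∇_w X_i`.
    rw [mul_sub, add_sub_assoc, sub_sub_cancel]
    congr 2
    refine Finset.sum_congr rfl fun i _ ↦ Finset.sum_congr rfl fun c _ ↦ ?_
    rw [Finset.prod_update_of_mem (Finset.mem_univ i)]
    have h2 : ∀ j : Fin k, (Function.update (fun j ↦ dh (a j) x) i (dh c x) j) (X j.castSucc x) =
        Function.update (fun j ↦ u a j x) i (dh c x (Fin.init X i x)) j := by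
      intro j
      rcases eq_or_ne j i with rfl | hj
      · simp [Fin.init]
      · simp [hj, u, Fin.init]
    simp only [h2, Finset.prod_update_of_mem (Finset.mem_univ i)]
    ring

end Connection

end Frames

/-! ### Existence of a dual frame, and extension of functions to Euclidean space. -/

section Embedding

variable {E : Type*} [NormedAddCommGroup E] [NormedSpace ℝ E]
  {H : Type*} [TopologicalSpace H] {I : ModelWithCorners ℝ E H}
  {M : Type*} [TopologicalSpace M] [ChartedSpace H M]

theorem mvfderiv_clm_comp {V V' : Type*} [NormedAddCommGroup V] [NormedSpace ℝ V]
    [NormedAddCommGroup V'] [NormedSpace ℝ V'] (A : V →L[ℝ] V') {ψ : M → V} {x : M}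
    (hψ : MDifferentiableAt I 𝓘(ℝ, V) ψ x) (w : TangentSpace I x) :
    mvfderiv I (fun y ↦ A (ψ y)) x w = A (mvfderiv I ψ x w) := by
  have h := mfderiv_comp_apply (I' := 𝓘(ℝ, V)) x A.mdifferentiableAt hψ w
  rw [mfderiv_eq_fderiv, A.fderiv] at h
  exact h

theorem mvfderiv_repr {V ι : Type*} [NormedAddCommGroup V] [NormedSpace ℝ V] [Finite ι]
    (b : Module.Basis ι ℝ V) {ψ : M → V} {x : M} (hψ : MDifferentiableAt I 𝓘(ℝ, V) ψ x)
    (w : TangentSpace I x) (a : ι) :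
    mvfderiv I (fun y ↦ b.repr (ψ y) a) x w = b.repr (mvfderiv I ψ x w) a := by
  have : FiniteDimensional ℝ V := b.finiteDimensional_of_finite
  exact mvfderiv_clm_comp (LinearMap.toContinuousLinearMap (b.coord a)) hψ w

variable [IsManifold I ∞ M] [FiniteDimensional ℝ E]

variable (I M) in
/-- A finite partition of unity whose members are supported where a bump function of a chart
is `1`. -/
theorem exists_finite_partition [T2Space M] [CompactSpace M] :
    ∃ (n : ℕ) (p : Fin n → M) (f : ∀ j, SmoothBumpFunction I (p j)) (ρ : Fin n → M → ℝ),
      (∀ j, ContMDiff I 𝓘(ℝ) ∞ (ρ j)) ∧ (∀ j, tsupport (ρ j) ⊆ interior {x | f j x = 1}) ∧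
      ∀ x, ∑ j, ρ j x = 1 := by
  let f (p : M) : SmoothBumpFunction I p := Classical.arbitrary _
  have hU (p : M) : p ∈ interior {x | f p x = 1} :=
    mem_interior_iff_mem_nhds.2 (f p).eventuallyEq_one
  obtain ⟨ρ, hρ⟩ := SmoothPartitionOfUnity.exists_isSubordinate I isClosed_univ
    (fun p : M ↦ interior {x | f p x = 1}) (fun _ ↦ isOpen_interior)
    (fun x _ ↦ Set.mem_iUnion.2 ⟨x, hU x⟩)
  have hfin := ρ.locallyFinite.finite_nonempty_of_compact
  let e := hfin.toFinset.equivFin.symm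
  refine ⟨_, fun j ↦ (e j : M), fun j ↦ f (e j), fun j ↦ ρ (e j), fun j ↦ (ρ _).contMDiff,
    fun j ↦ hρ _, fun x ↦ ?_⟩
  rw [← ρ.sum_eq_one (Set.mem_univ x), Equiv.sum_comp e (fun i ↦ ρ (i : M) x),
    Finset.sum_coe_sort hfin.toFinset (fun i ↦ ρ i x)]
  refine (finsum_eq_sum_of_support_subset _ fun i hi ↦ ?_).symm
  simp only [Set.Finite.coe_toFinset, Set.mem_ofPred_eq]
  exact ⟨x, hi⟩

/-- A smooth function on the target of an extended chart can be modified away from a compact set to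
a smooth function on the model space. -/
theorem exists_contDiff_eq_on_compact [I.Boundaryless] {s : M → ℝ} (hs : ContMDiff I 𝓘(ℝ) ∞ s)
    (p : M) {K : Set E} (hK : IsCompact K) (hKt : K ⊆ (extChartAt I p).target) :
    ∃ σ : E → ℝ, ContDiff ℝ ∞ σ ∧ ∀ z ∈ K, σ z = s ((extChartAt I p).symm z) := by
  have ho := isOpen_extChartAt_target (I := I) p
  obtain ⟨χ, h0, h1, -⟩ := exists_contMDiffMap_zero_one_nhds_of_isClosed 𝓘(ℝ, E) (n := ⊤)
    ho.isClosed_compl hK.isClosed (Set.disjoint_left.2 fun z hz hzK ↦ hz (hKt hzK))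
  refine ⟨fun z ↦ χ z * s ((extChartAt I p).symm z), ?_, fun z hz ↦ ?_⟩
  · rw [contDiff_iff_contDiffAt]
    intro z
    by_cases hz : z ∈ (extChartAt I p).target
    · have h2 : ContMDiffAt 𝓘(ℝ, E) I ∞ (extChartAt I p).symm z :=
        (contMDiffOn_extChartAt_symm p).contMDiffAt (ho.mem_nhds hz)
      exact (χ.contMDiff.contDiff.contDiffAt).mul ((hs.contMDiffAt.comp z h2).contDiffAt)
    · have h2 : ∀ᶠ u in nhds z, χ u = 0 := h0.filter_mono (nhds_le_nhdsSet hz)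
      refine (contDiffAt_const (c := (0 : ℝ))).congr_of_eventuallyEq ?_
      filter_upwards [h2] with u hu
      simp [hu]
  · have h2 : χ z = 1 := (h1.filter_mono (nhds_le_nhdsSet hz)).self_of_nhds
    simp [h2]

omit [FiniteDimensional ℝ E] in
theorem SmoothField.sum {ι : Type*} [Fintype ι] {X : ι → Π x : M, TangentSpace I x}
    (hX : ∀ i, SmoothField (X i)) : SmoothField (fun x ↦ ∑ i, X i x) :=
  ContMDiff.sum_section (s := Finset.univ) (V := fun x : M ↦ TangentSpace I x) (F := E)
    fun i _ ↦ hX i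

omit [FiniteDimensional ℝ E] in
theorem smoothField_smul_symmL {ρ : M → ℝ} (hρ : ContMDiff I 𝓘(ℝ) ∞ ρ) {p : M}
    (hsupp : tsupport ρ ⊆ (chartAt H p).source) (v : E) :
    SmoothField (I := I) (fun x ↦ ρ x • (trivializationAt E (TangentSpace I) p).symmL ℝ x v) := by
  refine ContMDiffOn.smul_section_of_tsupport (V := fun x : M ↦ TangentSpace I x) (F := E)
    (u := (chartAt H p).source) (s := fun x ↦ (trivializationAt E (TangentSpace I) p).symmL ℝ x v)
    hρ.contMDiffOn (chartAt H p).open_source hsupp ?_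
  have hb : (trivializationAt E (TangentSpace I) p).baseSet = (chartAt H p).source := rfl
  rw [← hb, (trivializationAt E (TangentSpace I) p).contMDiffOn_section_baseSet_iff]
  refine (contMDiffOn_const (c := v)).congr fun y hy ↦ ?_
  have h1 := (trivializationAt E (TangentSpace I) p).continuousLinearMapAt_symmL (R := ℝ) hy v
  rwa [Trivialization.continuousLinearMapAt_apply_of_mem ℝ (trivializationAt E (TangentSpace I) p) hy] at h1

variable (I M) in
/-- On a compact manifold there is a dual frame whose functions embed the manifold into a Euclidean
space, in such a way that all smooth functions extend. -/
theorem exists_isDualFrame [T2Space M] [CompactSpace M] [I.Boundaryless] :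
    ∃ (N : ℕ) (h : M → Fin N → ℝ) (Z : Fin N → Π x : M, TangentSpace I x), IsDualFrame h Z ∧
      ∀ s : M → ℝ, ContMDiff I 𝓘(ℝ) ∞ s → ∃ σ : (Fin N → ℝ) → ℝ,
        ContDiff ℝ ∞ σ ∧ HasCompactSupport σ ∧ ∀ x, s x = σ (h x) := by
  have : IsManifold I 1 M := .of_le (n := ∞) (by simp)
  obtain ⟨n, p, f, ρ, hρ, hsupp, hsum⟩ := exists_finite_partition I M
  have hsuppf (j) : interior {x | f j x = 1} ⊆ (chartAt H (p j)).source := fun x hx ↦ by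
    refine (f j).support_subset_source ?_
    have : x ∈ {x | f j x = 1} := interior_subset hx
    have : f j x = 1 := this
    simp [this]
  have hρU {j x} (h : ρ j x ≠ 0) : x ∈ interior {x | f j x = 1} :=
    hsupp j (subset_tsupport _ h)
  let e (j : Fin n) (x : M) : E := f j x • extChartAt I (p j) x
  have he (j) : ContMDiff I 𝓘(ℝ, E) ∞ (e j) := (f j).contMDiff_smul contMDiffOn_extChartAt
  -- The cut-off charts make the differentials span; recording the weights `ρ j` as well is what
  -- allows functions to be glued back when they are extended.
  let h₀ (x : M) (j : Fin n) : E × ℝ := (e j x, ρ j x)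
  have hh₀ : ContMDiff I 𝓘(ℝ, Fin n → E × ℝ) ∞ h₀ :=
    contMDiff_pi_space.2 fun j ↦ (he j).prodMk_space (hρ j)
  let B := Module.finBasis ℝ (Fin n → E × ℝ)
  let Bc : (Fin n → E × ℝ) ≃L[ℝ] (Fin _ → ℝ) := B.equivFun.toContinuousLinearEquiv
  let T (j : Fin n) (x : M) : E →L[ℝ] TangentSpace I x :=
    (trivializationAt E (TangentSpace I) (p j)).symmL ℝ x
  have hh : ContMDiff I 𝓘(ℝ, Fin (Module.finrank ℝ (Fin n → E × ℝ)) → ℝ) ∞ (fun x ↦ Bc (h₀ x)) :=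
    Bc.contDiff.contMDiff.comp hh₀
  have hT (j) (v : E) : SmoothField (I := I) (fun x ↦ ρ j x • T j x v) := by
    exact smoothField_smul_symmL (hρ j) ((hsupp j).trans (hsuppf j)) v
  have hZ (a) : SmoothField (I := I) (fun x ↦ ∑ j, ρ j x • T j x (B a j).1) :=
    SmoothField.sum fun j ↦ hT j (B a j).1
  refine ⟨_, fun x ↦ Bc (h₀ x), fun a x ↦ ∑ j, ρ j x • T j x (B a j).1, ⟨hh, hZ, ?_⟩, ?_⟩
  · intro x w
    have hd₀ : MDifferentiableAt I 𝓘(ℝ, Fin n → E × ℝ) h₀ x := hh₀.mdifferentiableAt (by simp)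
    have h1 (a) : mvfderiv I (fun y ↦ Bc (h₀ y) a) x w = B.repr (mvfderiv I h₀ x w) a :=
      mvfderiv_repr B hd₀ w a
    have h2 (j) : (mvfderiv I h₀ x w j).1 = mvfderiv I (e j) x w :=
      (mvfderiv_clm_comp ((ContinuousLinearMap.fst ℝ E ℝ).comp
        (ContinuousLinearMap.proj j : (Fin n → E × ℝ) →L[ℝ] E × ℝ)) hd₀ w).symm
    -- Where `ρ j ≠ 0`, the bump function is `1` nearby, so `e j` is locally the chart and `T j`
    -- inverts its differential.
    have h3 (j) : ρ j x • T j x (mvfderiv I (e j) x w) = ρ j x • w := by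
      by_cases hx : ρ j x = 0
      · simp [hx]
      congr 1
      have hxU := hρU hx
      have hev : e j =ᶠ[nhds x] extChartAt I (p j) := by
        filter_upwards [isOpen_interior.mem_nhds hxU] with y hy
        have : y ∈ {x | f j x = 1} := interior_subset hy
        have : f j y = 1 := this
        simp [e, this]
      have h4 : mvfderiv I (e j) x w =
          (trivializationAt E (TangentSpace I) (p j)).continuousLinearMapAt ℝ x w := by
        rw [TangentBundle.continuousLinearMapAt_trivializationAt (hsuppf j hxU), ← hev.mfderiv_eq]
        rfl
      rw [h4]
      exact Trivialization.symmL_continuousLinearMapAt _ (hsuppf j hxU) w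
    calc _ = ∑ j, ρ j x • T j x (∑ a, B.repr (mvfderiv I h₀ x w) a • B a j).1 := by
          simp only [h1, Finset.smul_sum, Prod.fst_sum, map_sum, Prod.smul_fst, map_smul]
          rw [Finset.sum_comm]
          refine Finset.sum_congr rfl fun j _ ↦ Finset.sum_congr rfl fun a _ ↦ ?_
          rw [smul_comm]
      _ = ∑ j, ρ j x • T j x (mvfderiv I h₀ x w j).1 := by
          refine Finset.sum_congr rfl fun j _ ↦ ?_
          have := congrFun (B.sum_repr (mvfderiv I h₀ x w)) j
          rw [Finset.sum_apply] at this
          rw [← this]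
          rfl
      _ = w := by
          simp only [h2, h3, ← Finset.sum_smul, hsum, one_smul]
  · intro s hs
    have hK (j) : IsCompact (extChartAt I (p j) '' tsupport (ρ j)) :=
      (isClosed_tsupport _).isCompact.image_of_continuousOn
        ((continuousOn_extChartAt (p j)).mono (by
          rw [extChartAt_source]; exact (hsupp j).trans (hsuppf j)))
    have hKt (j) : extChartAt I (p j) '' tsupport (ρ j) ⊆ (extChartAt I (p j)).target := by
      rintro _ ⟨x, hx, rfl⟩
      exact (extChartAt I (p j)).map_source (by
        rw [extChartAt_source]; exact hsuppf j (hsupp j hx))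
    choose σ hσ hσs using fun j ↦ exists_contDiff_eq_on_compact hs (p j) (hK j) (hKt j)
    have hcomp : IsCompact (Set.range fun x ↦ Bc (h₀ x)) := isCompact_range hh.continuous
    obtain ⟨R, hR⟩ := hcomp.isBounded.subset_closedBall 0
    let η : ContDiffBump (0 : Fin (Module.finrank ℝ (Fin n → E × ℝ)) → ℝ) :=
      ⟨max R 1, max R 1 + 1, by positivity, by linarith⟩
    have hη : ContDiff ℝ ∞ η := η.contDiff
    -- At `v = h x` the sum is `∑ j, ρ j x * s x = s x`. The cutoff `η` is `1` on a ball containing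
    -- the compact image of `M` and makes the support compact.
    refine ⟨fun v ↦ η v * ∑ j, (Bc.symm v j).2 * σ j (Bc.symm v j).1, ?_, ?_, fun x ↦ ?_⟩
    · have hc (j : Fin n) : ContDiff ℝ ∞ fun v ↦ Bc.symm v j :=
        (contDiff_apply ℝ (E × ℝ) j).comp Bc.symm.contDiff
      exact hη.mul (ContDiff.sum fun j _ ↦ (hc j).snd.mul ((hσ j).comp (hc j).fst))
    · exact η.hasCompactSupport.mul_right
    · have h1 : η (Bc (h₀ x)) = 1 := η.one_of_mem_closedBall
        (Metric.closedBall_subset_closedBall (le_max_left R 1) (hR ⟨x, rfl⟩))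
      have h2 (j) : ρ j x * σ j (e j x) = ρ j x * s x := by
        by_cases hx : ρ j x = 0
        · simp [hx]
        congr 1
        have hxU := hρU hx
        have h3 : x ∈ {x | f j x = 1} := interior_subset hxU
        have h3 : f j x = 1 := h3
        have h4 : e j x = extChartAt I (p j) x := by simp [e, h3]
        rw [h4, hσs j _ ⟨x, subset_tsupport _ hx, rfl⟩, (extChartAt I (p j)).left_inv
          (by rw [extChartAt_source]; exact hsuppf j hxU)]
      simp only [h1, one_mul, ContinuousLinearEquiv.symm_apply_apply]
      simp only [h₀, h2, ← Finset.sum_mul, hsum, one_mul]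

end Embedding

/-! ### Correcting the symmetrized derivatives order by order. -/

section Taylor

variable {E : Type*} [NormedAddCommGroup E] [NormedSpace ℝ E]
  {H : Type*} [TopologicalSpace H] {I : ModelWithCorners ℝ E H}
  {M : Type*} [TopologicalSpace M] [ChartedSpace H M] [IsManifold I ∞ M]

section Polynomial

variable {N k : ℕ} (c : (Fin k → Fin N) → ℝ)

theorem contDiff_sum_mul_prod :
    ContDiff ℝ ∞ (fun u : Fin N → ℝ ↦ ∑ a, c a * ∏ i, u (a i)) :=
  ContDiff.sum fun a _ ↦ contDiff_const.mul (contDiff_prod fun i _ ↦ contDiff_apply ℝ ℝ (a i))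

theorem flatAt_sum_mul_prod : FlatAt k (fun u : Fin N → ℝ ↦ ∑ a, c a * ∏ i, u (a i)) 0 := by
  have hp (a : Fin k → Fin N) : ContDiff ℝ ∞ (fun u : Fin N → ℝ ↦ ∏ i, u (a i)) :=
    contDiff_prod fun i _ ↦ contDiff_apply ℝ ℝ (a i)
  refine FlatAt.sum _ (fun a ↦ contDiff_const.mul (hp a)) fun a ↦
    FlatAt.mul_left contDiff_const (hp a) ?_
  have h := FlatAt.prod (p := (0 : Fin N → ℝ)) Finset.univ
    (fun i ↦ contDiff_apply ℝ ℝ (a i)) (fun i ↦ rfl)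
  simpa using h

/-- The polynomial is a multilinear map restricted to the diagonal, and its `k`-th derivative is the
sum of that map over all orders of the arguments. This is where symmetrization enters. -/
theorem iteratedFDeriv_sum_mul_prod (p : Fin N → ℝ) (v : Fin k → Fin N → ℝ) :
    iteratedFDeriv ℝ k (fun u : Fin N → ℝ ↦ ∑ a, c a * ∏ i, u (a i)) p v =
      ∑ s : Equiv.Perm (Fin k), ∑ a, c a * ∏ i, v (s i) (a i) := by
  let S : ContinuousMultilinearMap ℝ (fun _ : Fin k ↦ Fin N → ℝ) ℝ :=
    ∑ a, c a • (ContinuousMultilinearMap.mkPiAlgebra ℝ (Fin k) ℝ).compContinuousLinearMap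
      (fun i ↦ (ContinuousLinearMap.proj (a i) : (Fin N → ℝ) →L[ℝ] ℝ))
  have hS (w : Fin k → Fin N → ℝ) : S w = ∑ a, c a * ∏ i, w i (a i) := by
    simp [S]
  have h := S.iteratedFDeriv_comp_diagonal p v
  simpa only [hS] using h

variable {h : M → Fin N → ℝ} (hh : ContMDiff I 𝓘(ℝ, Fin N → ℝ) ∞ h)

omit [IsManifold I ∞ M] in
include hh in
theorem contMDiff_sub_point (y : M) : ContMDiff I 𝓘(ℝ, Fin N → ℝ) ∞ (fun x ↦ h x - h y) :=
  hh.sub contMDiff_const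

omit [IsManifold I ∞ M] in
include hh in
theorem contMDiff_polynomial (y : M) :
    ContMDiff I 𝓘(ℝ) ∞ (fun x ↦ ∑ a, c a * ∏ i, (h x (a i) - h y (a i))) :=
  (contDiff_sum_mul_prod c).contMDiff.comp (contMDiff_sub_point hh y)

include hh in
theorem vanishesTo_polynomial (y : M) :
    VanishesTo I y k (fun x ↦ ∑ a, c a * ∏ i, (h x (a i) - h y (a i))) := by
  refine FlatAt.vanishesTo (contDiff_sum_mul_prod c) (contMDiff_sub_point hh y) ?_
  rw [sub_self]
  exact flatAt_sum_mul_prod c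

include hh in
theorem lieIter_polynomial (y : M) {X : Fin k → Π x : M, TangentSpace I x}
    (hX : ∀ i, SmoothField (X i)) :
    lieIter (fun x ↦ ∑ a, c a * ∏ i, (h x (a i) - h y (a i))) k X y =
      ∑ s : Equiv.Perm (Fin k), ∑ a, c a * ∏ i, mvfderiv I (fun x ↦ h x (a i)) y (X (s i) y) := by
  have h1 := lieIter_comp_of_flatAt (Pi.basisFun ℝ (Fin N)) (contDiff_sum_mul_prod c)
    (contMDiff_sub_point hh y) (y := y) (by rw [sub_self]; exact flatAt_sum_mul_prod c) hX
  have h2 (b : Fin N) (w : TangentSpace I y) :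
      mvfderiv I (fun x ↦ (Pi.basisFun ℝ (Fin N)).repr (h x - h y) b) y w =
        mvfderiv I (fun x ↦ h x b) y w := by
    have h3 := mvfderiv_fun_sub ((contMDiff_pi_space.1 hh b).mdiffAt y)
      (mdifferentiableAt_const (I := I) (I' := 𝓘(ℝ)) (c := h y b))
    simp only [Pi.basisFun_repr, Pi.sub_apply, h3, mvfderiv_const, sub_zero]
  have h4 (v : Fin N → ℝ) : ∑ j, v j • Pi.basisFun ℝ (Fin N) j = v := by
    simpa using (Pi.basisFun ℝ (Fin N)).sum_repr v
  refine h1.trans ?_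
  simp only [h2]
  -- The sum over all permutations absorbs the reversal of the arguments.
  rw [iteratedFDeriv_sum_mul_prod, ← Equiv.sum_comp (Equiv.mulLeft (Fin.revPerm (n := k)))]
  refine Finset.sum_congr rfl fun s _ ↦ Finset.sum_congr rfl fun a _ ↦ ?_
  congr 1
  refine Finset.prod_congr rfl fun i _ ↦ ?_
  rw [h4]
  simp

end Polynomial

variable [FiniteDimensional ℝ E]
  {cov : CovariantDerivative I (E →L[ℝ] ℝ) (fun x : M ↦ CotangentSpace I x)}

theorem symCovDeriv_perm (f : M → ℝ) {k : ℕ} (X : Fin k → Π x : M, TangentSpace I x)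
    (t : Equiv.Perm (Fin k)) (x : M) :
    symCovDeriv cov f k (fun i ↦ X (t i)) x = symCovDeriv cov f k X x := by
  rw [symCovDeriv, symCovDeriv, ← Equiv.sum_comp (Equiv.mulLeft t)
    (fun s : Equiv.Perm (Fin k) ↦ iteratedCovDeriv cov f k (fun i ↦ X (s i)) x)]
  rfl

variable [hcov : CovariantDerivative.ContMDiffCovariantDerivative cov ∞]
  {N : ℕ} {h : M → Fin N → ℝ} {Z : Fin N → Π x : M, TangentSpace I x} {f g : M → ℝ} {k : ℕ}
  {X : Fin k → Π x : M, TangentSpace I x}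

namespace IsDualFrame

include hcov

theorem symCovDeriv_add (hF : IsDualFrame h Z) (hf : ContMDiff I 𝓘(ℝ) ∞ f)
    (hg : ContMDiff I 𝓘(ℝ) ∞ g) (hX : ∀ i, SmoothField (X i)) (x : M) :
    symCovDeriv cov (fun x ↦ f x + g x) k X x =
      symCovDeriv cov f k X x + symCovDeriv cov g k X x := by
  simp only [symCovDeriv, hF.iteratedCovDeriv_add hf hg fun i ↦ hX _, Finset.sum_add_distrib,
    mul_add]

theorem symCovDeriv_const_mul (hF : IsDualFrame h Z) (hf : ContMDiff I 𝓘(ℝ) ∞ f) (c : ℝ)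
    (hX : ∀ i, SmoothField (X i)) (x : M) :
    symCovDeriv cov (fun x ↦ c * f x) k X x = c * symCovDeriv cov f k X x := by
  simp only [symCovDeriv, hF.iteratedCovDeriv_const_mul hf c fun i ↦ hX _, ← Finset.mul_sum]
  ring

theorem symCovDeriv_sub (hF : IsDualFrame h Z) (hf : ContMDiff I 𝓘(ℝ) ∞ f)
    (hg : ContMDiff I 𝓘(ℝ) ∞ g) (hX : ∀ i, SmoothField (X i)) (x : M) :
    symCovDeriv cov (fun x ↦ f x - g x) k X x =
      symCovDeriv cov f k X x - symCovDeriv cov g k X x := by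
  have h1 := hF.symCovDeriv_add (cov := cov) hf
    (contMDiff_const (c := (-1 : ℝ)) |>.mul hg) hX x
  have h2 := hF.symCovDeriv_const_mul (cov := cov) hg (-1) hX x
  have h3 : (fun x ↦ f x - g x) = fun x ↦ f x + (-1) * g x := by
    funext x
    ring
  rw [h3]
  refine h1.trans ?_
  rw [sub_eq_add_neg, ← neg_one_mul (symCovDeriv cov g k X x), ← h2]
  rfl

theorem symCovDeriv_sum (hF : IsDualFrame h Z) {ι : Type*} (s : Finset ι) {f : ι → M → ℝ}
    (hf : ∀ j, ContMDiff I 𝓘(ℝ) ∞ (f j)) (c : ι → ℝ) (hX : ∀ i, SmoothField (X i)) (x : M) :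
    symCovDeriv cov (fun x ↦ ∑ j ∈ s, c j * f j x) k X x =
      ∑ j ∈ s, c j * symCovDeriv cov (f j) k X x := by
  classical
  have hcf (j) : ContMDiff I 𝓘(ℝ) ∞ (fun x ↦ c j * f j x) := contMDiff_const.mul (hf j)
  induction s using Finset.induction_on with
  | empty =>
    have := hF.symCovDeriv_const_mul (cov := cov) (contMDiff_const (c := (0 : ℝ))) 0 hX x
    simpa using this
  | insert a s ha ih =>
    simp only [Finset.sum_insert ha]
    rw [hF.symCovDeriv_add (hcf a) (contMDiff_finsetSum fun j _ ↦ hcf j) hX, ih,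
      hF.symCovDeriv_const_mul (hf a) _ hX]

theorem symCovDeriv_eq_zero (hF : IsDualFrame h Z) (hf : ContMDiff I 𝓘(ℝ) ∞ f) {y : M}
    (hv : VanishesTo I y (k + 1) f) (hX : ∀ i, SmoothField (X i)) :
    symCovDeriv cov f k X y = 0 := by
  have h1 (s : Equiv.Perm (Fin k)) : iteratedCovDeriv cov f k (fun i ↦ X (s i)) y = 0 :=
    (hF.vanishesTo_iteratedCovDeriv (m := 1) hf (by rwa [add_comm]) fun i ↦ hX (s i)).1.eq_zero
  simp [symCovDeriv, h1]

theorem iteratedCovDeriv_eq_sum (hF : IsDualFrame h Z) (hf : ContMDiff I 𝓘(ℝ) ∞ f)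
    (hX : ∀ i, SmoothField (X i)) (x : M) :
    iteratedCovDeriv cov f k X x = ∑ a : Fin k → Fin N,
      (∏ i, mvfderiv I (fun y ↦ h y (a i)) x (X i x)) *
        iteratedCovDeriv cov f k (fun i ↦ Z (a i)) x := by
  obtain ⟨Φ, hΦ⟩ := hF.exists_multilinearMap (cov := cov) hf k x
  rw [hΦ X hX, hF.multilinear_apply Φ]
  simp only [hΦ _ fun i ↦ hF.smoothField _]

/-- The symmetrized derivative of order `k` of the polynomial of degree `k` with coefficients
`(k!)⁻¹ ∇ᵏ f (Z a)` is that of `f`. -/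
theorem symCovDeriv_polynomial (hF : IsDualFrame h Z) (hf : ContMDiff I 𝓘(ℝ) ∞ f) (y : M)
    (hX : ∀ i, SmoothField (X i)) :
    symCovDeriv cov (fun x ↦ ∑ a : Fin k → Fin N,
      ((k.factorial : ℝ)⁻¹ * iteratedCovDeriv cov f k (fun i ↦ Z (a i)) y) *
        ∏ i, (h x (a i) - h y (a i))) k X y = symCovDeriv cov f k X y := by
  set c : (Fin k → Fin N) → ℝ := fun a ↦
    (k.factorial : ℝ)⁻¹ * iteratedCovDeriv cov f k (fun i ↦ Z (a i)) y with hc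
  -- `∇ᵏ` of the polynomial at `y` is already the symmetric form `∂ᵏ f`, so averaging it over the
  -- `k!` permutations changes nothing.
  have hlie (Y : Fin k → Π x : M, TangentSpace I x) (hY : ∀ i, SmoothField (Y i)) :
      iteratedCovDeriv cov (fun x ↦ ∑ a, c a * ∏ i, (h x (a i) - h y (a i))) k Y y =
        symCovDeriv cov f k Y y := by
    have h1 := (hF.vanishesTo_iteratedCovDeriv (cov := cov) (m := 0)
      (contMDiff_polynomial c hF.contMDiff y)
      (by rw [zero_add]; exact vanishesTo_polynomial c hF.contMDiff y) hY).2.eq_zero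
    rw [sub_eq_zero] at h1
    rw [h1, lieIter_polynomial c hF.contMDiff y hY, symCovDeriv, Finset.mul_sum]
    refine Finset.sum_congr rfl fun s _ ↦ ?_
    rw [hF.iteratedCovDeriv_eq_sum hf fun i ↦ hY (s i), Finset.mul_sum]
    refine Finset.sum_congr rfl fun a _ ↦ ?_
    simp only [hc]
    ring
  conv_lhs => rw [symCovDeriv]
  have h2 (s : Equiv.Perm (Fin k)) := (hlie (fun i ↦ X (s i)) fun i ↦ hX (s i)).trans
    (symCovDeriv_perm f X s y)
  simp only [hc] at h2
  simp only [h2, Finset.sum_const, Finset.card_univ, Fintype.card_perm, Fintype.card_fin,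
    nsmul_eq_mul]
  rw [inv_mul_cancel_left₀]
  exact_mod_cast k.factorial_ne_zero

end IsDualFrame

omit hcov

/-- The coefficients of the correction of order `n`. -/
noncomputable def taylorCoeff
    (cov : CovariantDerivative I (E →L[ℝ] ℝ) (fun x : M ↦ CotangentSpace I x))
    (Z : Fin N → Π x : M, TangentSpace I x) (F : M → M → ℝ) (n : ℕ) (a : Fin n → Fin N) (y : M) : ℝ :=
  -- Orders 0 and 1 of `x ↦ g x - g y` are the prescribed ones and must not be corrected.
  if n < 2 then 0 else (n.factorial : ℝ)⁻¹ * iteratedCovDeriv cov (F y) n (fun i ↦ Z (a i)) y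

/-- Functions of two variables whose symmetrized derivatives on the diagonal are successively
corrected to be those of `x ↦ g x - g y` at order at most one and to vanish at higher order. -/
noncomputable def taylorSeq
    (cov : CovariantDerivative I (E →L[ℝ] ℝ) (fun x : M ↦ CotangentSpace I x))
    (h : M → Fin N → ℝ) (Z : Fin N → Π x : M, TangentSpace I x) (g : M → ℝ) : ℕ → M → M → ℝ
  | 0, y, x => g x - g y
  | n + 1, y, x => taylorSeq cov h Z g n y x -
      ∑ a : Fin n → Fin N, taylorCoeff cov Z (taylorSeq cov h Z g n) n a y *
        ∏ i, (h x (a i) - h y (a i))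

include hcov in
theorem IsDualFrame.contMDiff_taylorCoeff (hF : IsDualFrame h Z) {F : M → M → ℝ}
    (hFs : ContMDiff (I.prod I) 𝓘(ℝ) ∞ (fun q : M × M ↦ F q.1 q.2)) (n : ℕ) (a : Fin n → Fin N) :
    ContMDiff I 𝓘(ℝ) ∞ (taylorCoeff cov Z F n a) := by
  unfold taylorCoeff
  split_ifs
  · exact contMDiff_const
  · exact contMDiff_const.mul ((hF.contMDiff_iteratedCovDeriv_snd (cov := cov) hFs
      fun i ↦ hF.smoothField (a i)).comp (contMDiff_id.prodMk contMDiff_id))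

include hcov in
theorem IsDualFrame.contMDiff_taylorSeq (hF : IsDualFrame h Z) (hg : ContMDiff I 𝓘(ℝ) ∞ g)
    (n : ℕ) : ContMDiff (I.prod I) 𝓘(ℝ) ∞ (fun q : M × M ↦ taylorSeq cov h Z g n q.1 q.2) := by
  induction n with
  | zero => exact (hg.comp contMDiff_snd).sub (hg.comp contMDiff_fst)
  | succ n ih =>
    exact ih.sub (contMDiff_finsetSum fun a _ ↦
      ((hF.contMDiff_taylorCoeff ih n a).comp contMDiff_fst).mul (contMDiff_finsetProd fun i _ ↦
        ((hF.contMDiff_apply (a i)).comp contMDiff_snd).sub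
          ((hF.contMDiff_apply (a i)).comp contMDiff_fst)))

omit [IsManifold I ∞ M] [FiniteDimensional ℝ E] in
theorem contMDiff_of_prod {F : M → M → ℝ}
    (hF : ContMDiff (I.prod I) 𝓘(ℝ) ∞ (fun q : M × M ↦ F q.1 q.2)) (y : M) :
    ContMDiff I 𝓘(ℝ) ∞ (F y) :=
  hF.comp (contMDiff_const.prodMk contMDiff_id)

theorem taylorSeq_of_le_two {n : ℕ} (hn : n ≤ 2) (y x : M) :
    taylorSeq cov h Z g n y x = g x - g y := by
  induction n with
  | zero => rfl
  | succ n ih => simp [taylorSeq, taylorCoeff, ih (by omega), show n < 2 by omega]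

theorem taylorSeq_eq_sub_sum (n : ℕ) (y x : M) :
    taylorSeq cov h Z g n y x = g x - g y - ∑ m ∈ Finset.range n, ∑ a : Fin m → Fin N,
      taylorCoeff cov Z (taylorSeq cov h Z g m) m a y * ∏ i, (h x (a i) - h y (a i)) := by
  induction n with
  | zero => simp [taylorSeq]
  | succ n ih =>
    rw [taylorSeq, ih, Finset.sum_range_succ]
    ring

theorem symCovDeriv_sub_const (hg : ContMDiff I 𝓘(ℝ) ∞ g) (hk : k < 2) (y : M) :
    symCovDeriv cov (fun x ↦ g x - g y) k X y =
      if k = 1 then ∑ i, mvfderiv I g y (X i y) else 0 := by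
  rcases k with _ | _ | k
  · simp [symCovDeriv, iteratedCovDeriv]
  · have h1 := mvfderiv_fun_sub (hg.mdiffAt y)
      (mdifferentiableAt_const (I := I) (I' := 𝓘(ℝ)) (c := g y))
    simp [symCovDeriv, iteratedCovDeriv, h1, mvfderiv_const]
  · omega

include hcov in
-- The step from `n` to `n + 1` with `n ≥ 2` cancels `∂ⁿ`, and keeps the lower orders since the
-- polynomial subtracted vanishes to order `n` at `y`.
theorem IsDualFrame.symCovDeriv_taylorSeq (hF : IsDualFrame h Z) (hg : ContMDiff I 𝓘(ℝ) ∞ g)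
    {n : ℕ} (hk : k < n) (hX : ∀ i, SmoothField (X i)) (y : M) :
    symCovDeriv cov (taylorSeq cov h Z g n y) k X y =
      if k = 1 then ∑ i, mvfderiv I g y (X i y) else 0 := by
  induction n with
  | zero => omega
  | succ n ih =>
    have hs (m) := contMDiff_of_prod (hF.contMDiff_taylorSeq (cov := cov) hg m) y
    rcases lt_or_ge n 2 with hn | hn
    · rw [show taylorSeq cov h Z g (n + 1) y = fun x ↦ g x - g y from
        funext fun x ↦ taylorSeq_of_le_two (by omega) y x]
      exact symCovDeriv_sub_const hg (by omega) y
    · have hp := contMDiff_polynomial (fun a ↦ taylorCoeff cov Z (taylorSeq cov h Z g n) n a y)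
        hF.contMDiff y
      rw [show taylorSeq cov h Z g (n + 1) y = fun x ↦ taylorSeq cov h Z g n y x -
        ∑ a : Fin n → Fin N, taylorCoeff cov Z (taylorSeq cov h Z g n) n a y *
        ∏ i, (h x (a i) - h y (a i)) from rfl, hF.symCovDeriv_sub (hs n) hp hX]
      rcases Nat.lt_succ_iff_lt_or_eq.1 hk with hkn | rfl
      · rw [ih hkn, hF.symCovDeriv_eq_zero hp
          ((vanishesTo_polynomial _ hF.contMDiff y).of_le hkn) hX, sub_zero]
      · simp only [taylorCoeff, if_neg (not_lt.2 hn)]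
        rw [hF.symCovDeriv_polynomial (hs k) y hX, sub_self, if_neg (by omega)]

include hcov in
/-- There is a smooth function of two variables whose symmetrized derivative of order one on the
diagonal is that of `g` and whose other symmetrized derivatives vanish on the diagonal. -/
theorem IsDualFrame.exists_symCovDeriv_eq (hF : IsDualFrame h Z)
    (hext : ∀ s : M → ℝ, ContMDiff I 𝓘(ℝ) ∞ s → ∃ σ : (Fin N → ℝ) → ℝ,
      ContDiff ℝ ∞ σ ∧ HasCompactSupport σ ∧ ∀ x, s x = σ (h x)) (hg : ContMDiff I 𝓘(ℝ) ∞ g) :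
    ∃ F : M → M → ℝ, ContMDiff (I.prod I) 𝓘(ℝ) ∞ (fun q : M × M ↦ F q.1 q.2) ∧
      ∀ (y : M) (k : ℕ) (X : Fin k → Π x : M, TangentSpace I x), (∀ i, SmoothField (X i)) →
        symCovDeriv cov (F y) k X y =
          if k = 1 then ∑ i, mvfderiv I g y (X i y) else 0 := by
  choose c hc hcs hch using fun n a ↦ hext _
    (hF.contMDiff_taylorCoeff (cov := cov) (hF.contMDiff_taylorSeq (cov := cov) hg n) n a)
  obtain ⟨T, hT, hflat⟩ := exists_contDiff_forall_flatAt hc hcs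
  have hFs : ContMDiff (I.prod I) 𝓘(ℝ) ∞
      (fun q : M × M ↦ g q.2 - g q.1 - T (h q.1, h q.2 - h q.1)) :=
    ((hg.comp contMDiff_snd).sub (hg.comp contMDiff_fst)).sub (hT.contMDiff.comp
      ((hF.contMDiff.comp contMDiff_fst).prodMk_space
        ((hF.contMDiff.comp contMDiff_snd).sub (hF.contMDiff.comp contMDiff_fst))))
  refine ⟨fun y x ↦ g x - g y - T (h y, h x - h y), hFs, fun y k X hX ↦ ?_⟩
  -- For each `k` separately, `F y` is the finite stage `k + 1` minus a Borel remainder `D`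
  -- vanishing to order `k + 1`, which `∂ᵏ` at `y` does not see.
  set D : M → ℝ := fun x ↦ T (h y, h x - h y) - ∑ n ∈ Finset.range (k + 1),
    ∑ a, c n a (h y) * ∏ i, (h x - h y) (a i) with hD
  have hψ : ContMDiff I 𝓘(ℝ, (Fin N → ℝ) × (Fin N → ℝ)) ∞ (fun x ↦ (h y, h x - h y)) :=
    contMDiff_const.prodMk_space (contMDiff_sub_point hF.contMDiff y)
  have hr : ContDiff ℝ ∞ (fun p : (Fin N → ℝ) × (Fin N → ℝ) ↦ T p -
      ∑ n ∈ Finset.range (k + 1), ∑ a, c n a p.1 * ∏ i, p.2 (a i)) :=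
    hT.sub (ContDiff.sum fun n _ ↦ ContDiff.sum fun a _ ↦ ((hc n a).comp contDiff_fst).mul
      (contDiff_prod fun i _ ↦ (contDiff_apply ℝ ℝ (a i)).comp contDiff_snd))
  have hDs : ContMDiff I 𝓘(ℝ) ∞ D := hr.contMDiff.comp hψ
  have hDv : VanishesTo I y (k + 1) D := by
    refine FlatAt.vanishesTo hr hψ ?_
    rw [sub_self]
    exact hflat (k + 1) (h y)
  have hs := contMDiff_of_prod (hF.contMDiff_taylorSeq (cov := cov) hg (k + 1)) y
  have heq : (fun x ↦ g x - g y - T (h y, h x - h y)) =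
      fun x ↦ taylorSeq cov h Z g (k + 1) y x - D x := by
    funext x
    rw [taylorSeq_eq_sub_sum, hD]
    simp only [hch, Pi.sub_apply]
    ring
  beta_reduce
  rw [heq, hF.symCovDeriv_sub hs hDs hX, hF.symCovDeriv_taylorSeq hg (Nat.lt_succ_self k) hX,
    hF.symCovDeriv_eq_zero hDs hDv hX, sub_zero]

end Taylor

end LinearPhase

/-! ### Assembly of the phase function. -/

theorem mainTheorem1
    {E : Type*} [NormedAddCommGroup E] [NormedSpace ℝ E] [FiniteDimensional ℝ E]
    {H : Type*} [TopologicalSpace H] (I : ModelWithCorners ℝ E H) [I.Boundaryless]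
    {M : Type*} [TopologicalSpace M] [ChartedSpace H M] [IsManifold I ∞ M]
    [T2Space M] [CompactSpace M]
    (cov : CovariantDerivative I (E →L[ℝ] ℝ) (fun x : M ↦ LinearPhase.CotangentSpace I x))
    [CovariantDerivative.ContMDiffCovariantDerivative cov ∞] :
    ∃ l : LinearPhase.CotangentBundle I M × M → ℝ,
      ContMDiff ((I.prod 𝓘(ℝ, E →L[ℝ] ℝ)).prod I) 𝓘(ℝ) ∞ l ∧
      (∀ x y : M, IsLinearMap ℝ
        (fun p : LinearPhase.CotangentSpace I y ↦ l (⟨y, p⟩, x))) ∧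
      ∀ (v : LinearPhase.CotangentBundle I M) (k : ℕ) (X : Fin k → Π x : M, TangentSpace I x),
        (∀ i, ContMDiff I (I.prod 𝓘(ℝ, E)) ∞
          (fun x ↦ (⟨x, X i x⟩ : TangentBundle I M))) →
        LinearPhase.symCovDeriv cov (fun x ↦ l (v, x)) k X v.proj =
          if h : k = 1 then v.2 (X ⟨0, by omega⟩ v.proj) else 0 := by
  obtain ⟨N, h, Z, hF, hext⟩ := LinearPhase.exists_isDualFrame I M
  choose F hFs hFd using fun a ↦ hF.exists_symCovDeriv_eq (cov := cov) hext (hF.contMDiff_apply a)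
  have hproj : ContMDiff (I.prod 𝓘(ℝ, E →L[ℝ] ℝ)) I ∞
      (fun v : LinearPhase.CotangentBundle I M ↦ v.proj) :=
    contMDiff_proj (fun x : M ↦ LinearPhase.CotangentSpace I x)
  have hpair (a : Fin N) : ContMDiff (I.prod 𝓘(ℝ, E →L[ℝ] ℝ)) 𝓘(ℝ) ∞
      (fun v : LinearPhase.CotangentBundle I M ↦ v.2 (Z a v.proj)) := by
    have h1 := ContMDiff.clm_bundle_apply (F₁ := E) (F₂ := ℝ) (n := ∞) (IB := I)
      (IM := I.prod 𝓘(ℝ, E →L[ℝ] ℝ)) (E₁ := fun y : M ↦ TangentSpace I y)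
      (E₂ := Bundle.Trivial M ℝ) (b := fun v : LinearPhase.CotangentBundle I M ↦ v.proj)
      (ϕ := fun v ↦ v.2) (v := fun v ↦ Z a v.proj) contMDiff_id ((hF.smoothField a).comp hproj)
    intro v
    have h2 := h1 v
    rw [contMDiffAt_totalSpace] at h2
    exact h2.2
  -- Linearity in the covector is built in: it enters only through the coefficients `v(Z_a)`, while
  -- `F a` depends on the base point alone.
  refine ⟨fun q ↦ ∑ a, q.1.2 (Z a q.1.proj) * F a q.1.proj q.2, ?_, fun x y ↦ ⟨?_, ?_⟩, ?_⟩
  · exact contMDiff_finsetSum fun a _ ↦ ((hpair a).comp contMDiff_fst).mul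
      ((hFs a).comp ((hproj.comp contMDiff_fst).prodMk contMDiff_snd))
  · intro p q
    simp [add_mul, Finset.sum_add_distrib]
  · intro r p
    simp [mul_assoc, Finset.mul_sum]
  · intro v k X hX
    refine (hF.symCovDeriv_sum (cov := cov) Finset.univ (f := fun a ↦ F a v.proj)
      (fun a ↦ LinearPhase.contMDiff_of_prod (hFs a) v.proj) (fun a ↦ v.2 (Z a v.proj)) hX
      v.proj).trans ?_
    simp only [hFd _ _ _ _ hX]
    split_ifs with hk
    · subst hk
      simp only [Fin.sum_univ_one]
      refine Eq.trans ?_ (congrArg v.2 (hF.sum_smul v.proj (X 0 v.proj)))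
      rw [map_sum]
      refine Finset.sum_congr rfl fun a _ ↦ ?_
      rw [map_smul, smul_eq_mul, mul_comm]
    · simp
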